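/- **Setting.** Let $\mathcal S$ be a finite set with a connected neighbourhood graph ($r\sim s$ for distinct $r,s$) and an injective energy function $E:\mathcal S\to\mathbb R$. For each $\beta>0$ let $\mathbf P_\beta=(p(r,s))$ be an irreducible transition matrix on $\mathcal S$ with $p(s,s)>0$ and, for $r\ne s$, $p(r,s)>0$ iff $r\sim s$, satisfying detailed balance $\pi(r)p(r,s)=\pi(s)p(s,r)$ with its stationary distribution $\pi=\pi_\beta$. Let $\gamma_\beta>0$ satisfy $\gamma_\beta\to0$, $\beta\gamma_\beta\to\infty$ as $\beta\to\infty$, and $$e^{-\beta((E(s)-E(r))^++\gamma_\beta/|\mathcal S|)}\le p(r,s)\le e^{-\beta((E(s)-E(r))^+-\gamma_\beta/|\mathcal S|)}\qquad(r\sim s).$$ Assume that $p^*(r,s)=\lim_{\beta\to\infty}p(r,s)$ exists for all $r,s$, is positive if $E(r)\ge E(s)$ and ($r\sim s$ or $r=s$), and is $0$ otherwise. **Valleys.** For distinct $r,s$, a self-avoiding path from $r$ to $s$ (along neighbours) is *minimal* if its maximal energy (end points included) is least possible; $z^*(r,s)$ is the state of maximal energy on a minimal path, and $z^*(r,r)=r$.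 Let $m^{(1)},\dots,m^{(\mathfrak n)}$ be the local minima of $E$ (the $s$ with $E(s)<E(r)$ for all $r\sim s$), labelled in any order (in particular, in the order in which one successively deletes a local minimum of least activation energy), and $M^{(i)}=\{m^{(i)},\dots,m^{(\mathfrak n)}\}$. For $m\in M^{(i)}$ let $V^{(i)}_<(m)$ be the set of $s$ with $E(z^*(s,m))<E(z^*(s,m'))$ for all $m'\in M^{(i)}\setminus\{m\}$. Write $s\leadsto m$ at level $i$ if $E(z^*(s,m))=\min_{n\in M^{(i)}}E(z^*(s,n))$ and every minimal path from $s$ to any $m'\in M^{(i)}\setminus\{m\}$ with $E(z^*(s,m'))=E(z^*(s,m))$ hits $V^{(i)}_<(m)$. Let $l(i)=\inf\{j: i<j\le\mathfrak n,\ m^{(i)}\leadsto m\text{ at level }j\text{ for some }m\in M^{(j)}\}$ ($\inf\emptyset=\infty$). Put $V^{(1)}(m)=\{s: s\leadsto m\text{ at level }1\}$ for $m\in M^{(1)}$ and, recursively, for $2\le i\le\mathfrak n$ and $m\in M^{(i)}$, $$V^{(i)}(m)=V^{(i-1)}(m)\cup\{s\in N^{(i-1)}: s\leadsto m\text{ at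 level }i\}\cup\bigcup_{j:\,l(j)=i,\ m^{(j)}\leadsto m\text{ at level }i}V^{(j)}(m^{(j)}),$$ where $N^{(i)}=\big(\bigcup_{j=1}^{\mathfrak n}V^{(i\wedge j)}(m^{(j)})\big)^c$ is the set of non-assigned states at level $i$. The level $i$ metastates are $\mathcal S^{(i)}=\{m^{(j)}: l(j)>i\}\cup N^{(i)}$, with $V^{(i)}(m^{(j)}):=V^{(j)}(m^{(j)})$ for $j<i$ and $V^{(i)}(s):=\{s\}$ for $s\in N^{(i)}$; the sets $V^{(i)}(s)$, $s\in\mathcal S^{(i)}$, partition $\mathcal S$. For $r\in\mathcal S^{(i)}\setminus N^{(i)}$ let $s_r$ be the state of least energy among the states outside $V^{(i)}(r)$ that are adjacent to $V^{(i)}(r)$. **Aggregation.** For each $\beta>0$ let $X=(X_n)_{n\ge0}$ be a Markov chain with transition matrix $\mathbf P_\beta$ and an arbitrary initial distribution (which may depend on $\beta$). Let $\overline Y^{(i)}_n$ be the $s\in\mathcal S^{(i)}$ with $X_n\in V^{(i)}(s)$, let $\sigma_0=0$, $\sigma_{n+1}=\inf\{k>\sigma_n:\overline Y^{(i)}_k\ne\overline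 Y^{(i)}_{k-1}\}$, and let $Y^{(i)}_n=\overline Y^{(i)}_{\sigma_n}$ be the accelerated aggregated chain at level $i$. **Proposition.** Let $1\le i<\mathfrak n$. For $r\in\mathcal S^{(i)}\setminus N^{(i)}$ put $\widehat p(r,\cdot)=\delta_{s_r}$, and for $r\in N^{(i)}$ put $$\widehat p(r,\cdot)=\frac1{1-p^*(r,r)}\Bigg(\sum_{s\in N^{(i)},\,s\sim r}p^*(r,s)\,\delta_s+\sum_{s\in\mathcal S^{(i)}\setminus N^{(i)}}\Big(\sum_{r'\in V^{(i)}(s),\,r'\sim r}p^*(r,r')\Big)\delta_s\Bigg).$$ Then $\widehat p$ is a transition matrix on $\mathcal S^{(i)}$, and $Y^{(i)}$ converges, as $\beta\to\infty$, to a Markov chain on $\mathcal S^{(i)}$ with transition probabilities $\widehat p$, in the sense that $$\lim_{\beta\to\infty}\mathbb P\big(Y^{(i)}_{n+1}=s\,\big|\,Y^{(i)}_n=r,\,Y^{(i)}_{n-1}=m_{n-1},\dots,Y^{(i)}_0=m_0\big)=\widehat p(r,s)$$ for all $n\ge0$ and $m_0,\dots,m_{n-1},r,s\in\mathcal S^{(i)}$,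 the limit being taken along those $\beta$ for which the conditioning event has positive probability. -/

import Mathlib

open Filter Topology MeasureTheory ProbabilityTheory

noncomputable section

/-- An energy landscape on a finite state space: the neighbourhood graph (`r ∼ s`), a
non-degenerate energy function, and a labelling `m⁽¹⁾, …, m⁽ⁿ⁾` of the local minima, in the order in
which they are removed from the metastable sets `M⁽ⁱ⁾ = {m⁽ⁱ⁾, …, m⁽ⁿ⁾}`. Any order is allowed. -/
structure EnergyLandscape (S : Type*) where
  /-- the neighbourhood relation between distinct states -/
  graph : SimpleGraph S
  energy : S → ℝ
  energy_injective : Function.Injective energy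
  numMinima : ℕ
  /-- `minimum j` is `m⁽ʲ⁾`, for `1 ≤ j ≤ numMinima` -/
  minimum : ℕ → S
  minimum_bijOn : Set.BijOn minimum (Set.Icc 1 numMinima)
    {s | ∀ r, graph.Adj s r → energy s < energy r}

namespace EnergyLandscape

variable {S : Type*} (L : EnergyLandscape S)

/-- The metastable set `M⁽ⁱ⁾`. -/
def metastable (i : ℕ) : Set S := L.minimum '' Set.Icc i L.numMinima

/-- The maximal energy along a path (both end points included). -/
def peak {r s : S} (w : L.graph.Walk r s) : ℝ := sSup (L.energy '' {t | t ∈ w.support})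

/-- `w ∈ Γ*(r,s)`: a self-avoiding path whose maximal energy is minimal among all self-avoiding
paths from `r` to `s`. -/
def IsMinimalPath {r s : S} (w : L.graph.Walk r s) : Prop :=
  w.IsPath ∧ ∀ w' : L.graph.Walk r s, w'.IsPath → L.peak w ≤ L.peak w'

open Classical in
/-- The essential saddle `z*(r,s)`: the state of maximal energy on a minimal path from `r` to `s`
(`z*(r,r) = r`). It does not depend on the minimal path, and it exists in a connected graph on a
finite set; the value `r` in the other case is a dummy. -/
def saddle (r s : S) : S :=
  if h : ∃ t, ∃ w : L.graph.Walk r s,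
      L.IsMinimalPath w ∧ t ∈ w.support ∧ ∀ u ∈ w.support, L.energy u ≤ L.energy t
  then h.choose else r

/-- `V_<⁽ⁱ⁾(m)`. -/
def innerValley (i : ℕ) (m : S) : Set S :=
  {s | ∀ m' ∈ L.metastable i, m' ≠ m →
    L.energy (L.saddle s m) < L.energy (L.saddle s m')}

/-- `s ⇝ m` at level `i`: state `s` is attracted by `m ∈ M⁽ⁱ⁾`. -/
def Attracted (i : ℕ) (s m : S) : Prop :=
  m ∈ L.metastable i ∧
  (∀ m' ∈ L.metastable i, L.energy (L.saddle s m) ≤ L.energy (L.saddle s m')) ∧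
  ∀ m' ∈ L.metastable i, m' ≠ m → L.energy (L.saddle s m') = L.energy (L.saddle s m) →
    ∀ w : L.graph.Walk s m', L.IsMinimalPath w → ∃ t ∈ w.support, t ∈ L.innerValley i m

/-- `l(j)`: the least level `k` with `j < k ≤ n` at which `m⁽ʲ⁾` is attracted by an element of
`M⁽ᵏ⁾` (infinite if there is none). -/
def mergeLevel (j : ℕ) : ℕ∞ :=
  sInf {k : ℕ∞ | ∃ k' : ℕ, k = k' ∧ j < k' ∧ k' ≤ L.numMinima ∧
    ∃ m ∈ L.metastable k', L.Attracted k' (L.minimum j) m}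

/-- `valleyOrder i j` is the valley `V⁽ⁱ ᐱ ʲ⁾(m⁽ʲ⁾)`, `1 ≤ i, j ≤ n`. For `j < i` it is unchanged
since level `j`. For `i ≤ j` the valley `V⁽ⁱ⁾(m⁽ʲ⁾)` consists of `V⁽ⁱ⁻¹⁾(m⁽ʲ⁾)`, of the states that
are non-assigned at level `i - 1` and attracted by `m⁽ʲ⁾` at level `i`, and of the valleys
`V⁽ᵏ⁾(m⁽ᵏ⁾)` with `l(k) = i` and `m⁽ᵏ⁾ ⇝ m⁽ʲ⁾` at level `i`. At level `0` nothing is assigned, so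
that `V⁽¹⁾(m⁽ʲ⁾)` is the set of the states attracted by `m⁽ʲ⁾` at level `1`. -/
def valleyOrder : ℕ → ℕ → Set S
  | 0, _ => ∅
  | i + 1, j =>
    if j < i + 1 then valleyOrder i j
    else valleyOrder i j ∪
      {s | (∀ k ∈ Set.Icc 1 L.numMinima, s ∉ valleyOrder i k) ∧
        L.Attracted (i + 1) s (L.minimum j)} ∪
      ⋃ k ∈ {k : ℕ | 1 ≤ k ∧ k < i + 1 ∧ L.mergeLevel k = ((i + 1 : ℕ) : ℕ∞) ∧
        L.Attracted (i + 1) (L.minimum k) (L.minimum j)}, valleyOrder i k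

/-- `N⁽ⁱ⁾`: the states that are non-assigned at level `i`. -/
def nonassigned (i : ℕ) : Set S := (⋃ j ∈ Set.Icc 1 L.numMinima, L.valleyOrder i j)ᶜ

/-- The level `i` metastates `S⁽ⁱ⁾ = {m⁽ʲ⁾ | l(j) > i} ∪ N⁽ⁱ⁾`. -/
def metastates (i : ℕ) : Set S :=
  {s | ∃ j ∈ Set.Icc 1 L.numMinima, (i : ℕ∞) < L.mergeLevel j ∧ s = L.minimum j} ∪
    L.nonassigned i

/-- `V⁽ⁱ⁾(s)` for a metastate `s`: `V⁽ⁱ ᐱ ʲ⁾(m⁽ʲ⁾)` if `s = m⁽ʲ⁾`, and `{s}` if `s ∈ N⁽ⁱ⁾`. -/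
def valley (i : ℕ) (s : S) : Set S :=
  {x | (∃ j ∈ Set.Icc 1 L.numMinima, s = L.minimum j ∧ x ∈ L.valleyOrder i j) ∨
    (s ∈ L.nonassigned i ∧ x = s)}

/-- `∂⁺V`: the states outside `V` which are adjacent to a state in `V`. -/
def outerBoundary (V : Set S) : Set S := {s | s ∉ V ∧ ∃ r ∈ V, L.graph.Adj r s}

open Classical in
/-- `s_m⁽ⁱ⁾`: the state of least energy in `∂⁺V⁽ⁱ⁾(m)` (a dummy value if `∂⁺V⁽ⁱ⁾(m)` is empty). -/
def exitState [Finite S] (i : ℕ) (m : S) : S :=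
  if h : (L.outerBoundary (L.valley i m)).Nonempty then
    (Set.exists_min_image (L.outerBoundary (L.valley i m)) L.energy (Set.toFinite _) h).choose
  else m

open Classical in
/-- The level `i` metastate `s ∈ S⁽ⁱ⁾` with `x ∈ V⁽ⁱ⁾(s)`, so that the aggregated chain is
`n ↦ L.metastateOf i (X n)`. (The sets `V⁽ⁱ⁾(s)`, `s ∈ S⁽ⁱ⁾`, form a partition of `S`.) -/
def metastateOf (i : ℕ) (x : S) : S :=
  if h : ∃ s, s ∈ L.metastates i ∧ x ∈ L.valley i s then h.choose else x

end EnergyLandscape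

/-- The successive jump times `σ₀ = 0`, `σₙ₊₁ = inf {k > σₙ | y k ≠ y (k - 1)}` of a sequence. -/
def jumpTime {α : Type*} (y : ℕ → α) : ℕ → ℕ∞
  | 0 => 0
  | n + 1 => sInf {k : ℕ∞ | ∃ k' : ℕ, k = k' ∧ jumpTime y n < k' ∧ y k' ≠ y (k' - 1)}

/-- The accelerated sequence takes the value `a` at `n`, that is, `σₙ < ∞` and `y σₙ = a`. -/
def AcceleratedEq {α : Type*} (y : ℕ → α) (n : ℕ) (a : α) : Prop :=
  ∃ k : ℕ, jumpTime y n = k ∧ y k = a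

/-- Transition matrices `P β` with stationary distributions `π β`, for each inverse temperature
`β > 0`, driven by the energy landscape `L`. -/
structure LowTemperatureChain {S : Type*} [Fintype S] (L : EnergyLandscape S) where
  P : ℝ → Matrix S S ℝ
  π : ℝ → S → ℝ
  γ : ℝ → ℝ
  /-- the limits `p*(r,s)` -/
  pstar : S → S → ℝ
  row_sum : ∀ β > 0, ∀ r, ∑ s, P β r s = 1
  /-- includes that the entries of `P β` are nonnegative -/
  irreducible : ∀ β > 0, (P β).IsIrreducible
  /-- `p(s,s) > 0`, and two distinct states are neighbours iff `p(r,s) > 0`, iff `p(s,r) > 0`;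
  the neighbourhood graph is the same for all `β`. -/
  pos_iff : ∀ β > 0, ∀ r s, 0 < P β r s ↔ r = s ∨ L.graph.Adj r s
  π_mem : ∀ β > 0, π β ∈ stdSimplex ℝ S
  stationary : ∀ β > 0, Matrix.vecMul (π β) (P β) = π β
  reversible : ∀ β > 0, ∀ r s, π β r * P β r s = π β s * P β s r
  γ_pos : ∀ β > 0, 0 < γ β
  γ_tendsto : Tendsto γ atTop (𝓝 0)
  mul_γ_tendsto : Tendsto (fun β => β * γ β) atTop atTop
  lower_bound : ∀ β > 0, ∀ r s, L.graph.Adj r s →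
    Real.exp (-β * (max (L.energy s - L.energy r) 0 + γ β / Fintype.card S)) ≤ P β r s
  upper_bound : ∀ β > 0, ∀ r s, L.graph.Adj r s →
    P β r s ≤ Real.exp (-β * (max (L.energy s - L.energy r) 0 - γ β / Fintype.card S))
  tendsto_pstar : ∀ r s, Tendsto (fun β => P β r s) atTop (𝓝 (pstar r s))
  pstar_pos : ∀ r s, (r = s ∨ L.graph.Adj r s) → L.energy s ≤ L.energy r → 0 < pstar r s
  pstar_eq_zero : ∀ r s, ¬ ((r = s ∨ L.graph.Adj r s) ∧ L.energy s ≤ L.energy r) → pstar r s = 0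

namespace LowTemperatureChain

variable {S : Type*} [Fintype S] {L : EnergyLandscape S} (C : LowTemperatureChain L)

open Classical in
/-- The transition probabilities `p̂ᵢ(r,s)` of the asymptotic jump chain at level `i`: the point mass
at `s_r` if `r` is a valley minimum, and the normalized limits `p*` of the transition probabilities
to the (distinct) neighbours of `r`, collected according to metastates, if `r ∈ N⁽ⁱ⁾`. -/
def limitTransition (i : ℕ) (r s : S) : ℝ :=
  if r ∈ L.nonassigned i then
    (1 - C.pstar r r)⁻¹ *
      (if s ∈ L.nonassigned i then
        (if L.graph.Adj r s then C.pstar r s else 0)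
      else if s ∈ L.metastates i then
        ∑ r' : S with L.graph.Adj r r' ∧ r' ∈ L.valley i s, C.pstar r r'
      else 0)
  else if s = L.exitState i r then 1 else 0

end LowTemperatureChain

/-- `X` is a (temporally homogeneous) Markov chain with transition matrix `P` and an arbitrary
initial distribution, on the probability space `(Ω, μ)`. -/
structure IsMarkovChain {S : Type*} (P : Matrix S S ℝ) {Ω : Type*} [MeasurableSpace Ω]
    (μ : Measure Ω) (X : ℕ → Ω → S) : Prop where
  isProbabilityMeasure : IsProbabilityMeasure μ
  measurable : ∀ n s, MeasurableSet {ω | X n ω = s}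
  markov : ∀ (n : ℕ) (x : ℕ → S),
    μ {ω | ∀ k ≤ n + 1, X k ω = x k} =
      μ {ω | ∀ k ≤ n, X k ω = x k} * ENNReal.ofReal (P (x n) (x (n + 1)))

/-- The event `{Yₙ⁽ⁱ⁾ = s}` for the accelerated aggregated chain `Y⁽ⁱ⁾` at level `i` associated with
`X`: the `n`-th jump time `σₙ` of the aggregated chain `k ↦ L.metastateOf i (X k)` is finite, and at
that time the aggregated chain is in `s`. -/
def aacEvent {S : Type*} (L : EnergyLandscape S) (i : ℕ) {Ω : Type*} (X : ℕ → Ω → S) (n : ℕ)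
    (s : S) : Set Ω :=
  {ω | AcceleratedEq (fun k => L.metastateOf i (X k ω)) n s}

/-- `p(r,·)` is, for every `r ∈ A`, a probability distribution on `A`. -/
def IsTransitionFunctionOn {S : Type*} [Fintype S] (A : Set S) (p : S → S → ℝ) : Prop :=
  ∀ r ∈ A, (∀ s, 0 ≤ p r s) ∧ (∀ s, s ∉ A → p r s = 0) ∧ ∑ s, p r s = 1

end

/-! The argument combines the geometry of the landscape, an exit estimate for reversible chains, and
the Markov property at jump times.

Geometry. The communication height `height x y` is at most `H` exactly when `x` and `y` lie in one
component of the sublevel set of `H` (`height_le_iff`), so it obeys the ultrametric inequality. This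
makes attraction consistent between levels: a state's earlier attractor is itself attracted by any
later one (`Attracted.attracted`). Hence valleys of distinct metastates are disjoint
(`eq_of_mem_valleyOrder`), and a neighbour `y` outside a valley lies strictly above some walk,
inside the valley, from the adjacent valley state to the minimum (`joinedWithin_valleyOrder`). Two
valleys therefore never touch, and every exit leads to a non-assigned state.

Exit. By detailed balance the chain is an electrical network in which an edge has conductance `exp
(-β * E)`, up to a factor `exp (o(β))`, where `E` is the energy of its higher end point. Dirichlet's
principle bounds the variation of a hitting probability along an edge by the total conductance of
the undesired exits divided by that of the edge. So a target reached by a walk below all undesired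
exits is hit first with probability tending to `1` (`HitsWhp.of_joinedWithin`). Applied to
attractors and then to the lowest exit, this gives `hitsWhp_exitState`. From a non-assigned state,
removing the holding time divides by `1 - p*(r,r)`.

Jump times. These estimates hold from every point of the finite valley, hence uniformly. Splitting
over the value of the `n`-th jump time, each piece is determined by the trajectory up to that time,
so the past affects only the starting point in the valley (`IsMarkovChain.cond_aacEvent_mem_Icc`).
-/

namespace EnergyLandscape

variable {S : Type*} (L : EnergyLandscape S)

/-! ### Communication within a set, and communication heights -/

/-- `x` and `y` are joined by a walk all of whose vertices, end points included, lie in `A`. -/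
def JoinedWithin (A : Set S) (x y : S) : Prop :=
  ∃ w : L.graph.Walk x y, ∀ v ∈ w.support, v ∈ A

variable {L}

theorem JoinedWithin.refl {A : Set S} {x : S} (hx : x ∈ A) : L.JoinedWithin A x x :=
  ⟨.nil, by simpa using hx⟩

theorem JoinedWithin.cons {A : Set S} {x y z : S} (hx : x ∈ A) (h : L.graph.Adj x y)
    (hyz : L.JoinedWithin A y z) : L.JoinedWithin A x z := by
  obtain ⟨w, hw⟩ := hyz
  refine ⟨.cons h w, fun v hv => ?_⟩
  rw [SimpleGraph.Walk.support_cons, List.mem_cons] at hv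
  rcases hv with rfl | hv
  exacts [hx, hw v hv]

theorem JoinedWithin.symm {A : Set S} {x y : S} (h : L.JoinedWithin A x y) :
    L.JoinedWithin A y x := by
  obtain ⟨w, hw⟩ := h
  exact ⟨w.reverse, fun v hv => hw v (by simpa using hv)⟩

theorem JoinedWithin.trans {A : Set S} {x y z : S} (h : L.JoinedWithin A x y)
    (h' : L.JoinedWithin A y z) : L.JoinedWithin A x z := by
  obtain ⟨w, hw⟩ := h
  obtain ⟨w', hw'⟩ := h'
  refine ⟨w.append w', fun v hv => ?_⟩
  rcases SimpleGraph.Walk.mem_support_append_iff _ _ |>.1 hv with hv | hv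
  exacts [hw v hv, hw' v hv]

theorem JoinedWithin.mono {A B : Set S} (hAB : A ⊆ B) {x y : S} (h : L.JoinedWithin A x y) :
    L.JoinedWithin B x y :=
  h.imp fun _ hw v hv => hAB (hw v hv)

theorem JoinedWithin.left_mem {A : Set S} {x y : S} (h : L.JoinedWithin A x y) : x ∈ A :=
  h.elim fun w hw => hw x w.start_mem_support

theorem JoinedWithin.right_mem {A : Set S} {x y : S} (h : L.JoinedWithin A x y) : y ∈ A :=
  h.symm.left_mem

theorem JoinedWithin.of_adj {A : Set S} {x y : S} (hx : x ∈ A) (hy : y ∈ A)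
    (h : L.graph.Adj x y) : L.JoinedWithin A x y :=
  .cons hx h (.refl hy)

/-- A property which propagates backwards along the edges within `A` propagates along walks. -/
theorem JoinedWithin.induction {A : Set S} {y : S} {p : S → Prop} (hy : p y)
    (step : ∀ a b, a ∈ A → b ∈ A → L.graph.Adj a b → L.JoinedWithin A b y → p b → p a) {x : S}
    (h : L.JoinedWithin A x y) : p x := by
  obtain ⟨w, hw⟩ := h
  induction w with
  | nil => exact hy
  | @cons a b c hab w ih =>
    have hw' : ∀ v ∈ w.support, v ∈ A := fun v hv => hw v (by simp [hv])
    exact step a b (hw a (by simp)) (hw' b w.start_mem_support) hab ⟨w, hw'⟩ (ih hy step hw')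

/-- A walk either stays in `B` or leaves `B` for the first time through some edge. -/
theorem JoinedWithin.inter_or_exit {A : Set S} (B : Set S) {x y : S} (h : L.JoinedWithin A x y)
    (hx : x ∈ B) : L.JoinedWithin (A ∩ B) x y ∨
      ∃ q p, L.JoinedWithin (A ∩ B) x q ∧ L.graph.Adj q p ∧ p ∈ A ∧ p ∉ B ∧
        L.JoinedWithin A p y := by
  revert hx
  refine h.induction (p := fun x => x ∈ B → L.JoinedWithin (A ∩ B) x y ∨
      ∃ q p, L.JoinedWithin (A ∩ B) x q ∧ L.graph.Adj q p ∧ p ∈ A ∧ p ∉ B ∧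
        L.JoinedWithin A p y) (fun hy => .inl (.refl ⟨h.right_mem, hy⟩)) ?_
  intro a b ha hb hab hby ih haB
  by_cases hbB : b ∈ B
  · rcases ih hbB with h | ⟨q, p, h1, h2⟩
    · exact .inl (.cons ⟨ha, haB⟩ hab h)
    · exact .inr ⟨q, p, .cons ⟨ha, haB⟩ hab h1, h2⟩
  · exact .inr ⟨a, b, .refl ⟨ha, haB⟩, hab, hb, hbB, hby⟩

variable (L) in
/-- The communication height `E(z*(x,y))`. -/
noncomputable def height (x y : S) : ℝ := L.energy (L.saddle x y)

section Finite

variable [Finite S]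

theorem le_peak {r s : S} (w : L.graph.Walk r s) {v : S} (hv : v ∈ w.support) :
    L.energy v ≤ L.peak w :=
  le_csSup (Set.toFinite _).bddAbove ⟨v, hv, rfl⟩

theorem exists_energy_eq_peak {r s : S} (w : L.graph.Walk r s) :
    ∃ t ∈ w.support, L.energy t = L.peak w := by
  have := Set.Nonempty.csSup_mem (s := L.energy '' {t | t ∈ w.support})
    ⟨_, r, w.start_mem_support, rfl⟩ (Set.toFinite _)
  obtain ⟨t, ht, h⟩ := this
  exact ⟨t, ht, h⟩

theorem peak_le {r s : S} (w : L.graph.Walk r s) {H : ℝ} (h : ∀ v ∈ w.support, L.energy v ≤ H) :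
    L.peak w ≤ H := by
  obtain ⟨t, ht, he⟩ := exists_energy_eq_peak w
  exact he ▸ h t ht

theorem exists_isMinimalPath (hc : L.graph.Preconnected) (r s : S) :
    ∃ w : L.graph.Walk r s, L.IsMinimalPath w := by
  classical
  obtain ⟨w₀⟩ := hc r s
  -- Every peak is the energy of some state, so only finitely many values compete.
  have hfin : {h : ℝ | ∃ w : L.graph.Walk r s, w.IsPath ∧ L.peak w = h}.Finite := by
    refine (Set.finite_range L.energy).subset ?_
    rintro _ ⟨w, -, rfl⟩
    obtain ⟨t, -, ht⟩ := exists_energy_eq_peak w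
    exact ⟨t, ht⟩
  obtain ⟨_, ⟨w, hw, rfl⟩, hmin⟩ := Set.exists_min_image _ id hfin
    ⟨_, w₀.bypass, w₀.bypass_isPath, rfl⟩
  exact ⟨w, hw, fun w' hw' => hmin _ ⟨w', hw', rfl⟩⟩

theorem exists_height_eq_peak (hc : L.graph.Preconnected) (r s : S) :
    ∃ w : L.graph.Walk r s, L.IsMinimalPath w ∧ L.height r s = L.peak w := by
  have h : ∃ t, ∃ w : L.graph.Walk r s,
      L.IsMinimalPath w ∧ t ∈ w.support ∧ ∀ u ∈ w.support, L.energy u ≤ L.energy t := by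
    obtain ⟨w, hw⟩ := exists_isMinimalPath hc r s
    obtain ⟨t, ht, he⟩ := exists_energy_eq_peak w
    exact ⟨t, w, hw, ht, fun u hu => he ▸ le_peak w hu⟩
  obtain ⟨w, hw, ht, hu⟩ := h.choose_spec
  refine ⟨w, hw, ?_⟩
  rw [height, saddle, dif_pos h]
  exact le_antisymm (le_peak w ht) (peak_le w hu)

theorem peak_eq_height (hc : L.graph.Preconnected) {r s : S} {w : L.graph.Walk r s}
    (hw : L.IsMinimalPath w) : L.peak w = L.height r s := by
  obtain ⟨w', hw', h⟩ := exists_height_eq_peak hc r s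
  exact h ▸ le_antisymm (hw.2 _ hw'.1) (hw'.2 _ hw.1)

/-- Erasing loops only removes vertices, so self-avoidance can be dropped. Later arguments use only
this sublevel connectivity. -/
theorem height_le_iff (hc : L.graph.Preconnected) {x y : S} {H : ℝ} :
    L.height x y ≤ H ↔ L.JoinedWithin {v | L.energy v ≤ H} x y := by
  classical
  constructor
  · intro h
    obtain ⟨w, -, hw⟩ := exists_height_eq_peak hc x y
    exact ⟨w, fun v hv => (le_peak w hv).trans (hw ▸ h)⟩
  · rintro ⟨w, hw⟩
    obtain ⟨w', hw', h⟩ := exists_height_eq_peak hc x y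
    rw [h]
    exact (hw'.2 _ w.bypass_isPath).trans
      (peak_le _ fun v hv => hw v (w.support_bypass_subset_support hv))

theorem joinedWithin_height (hc : L.graph.Preconnected) (x y : S) :
    L.JoinedWithin {v | L.energy v ≤ L.height x y} x y :=
  (height_le_iff hc).1 le_rfl

theorem height_comm (hc : L.graph.Preconnected) (x y : S) : L.height x y = L.height y x :=
  le_antisymm ((height_le_iff hc).2 (joinedWithin_height hc y x).symm)
    ((height_le_iff hc).2 (joinedWithin_height hc x y).symm)

theorem height_le_trans (hc : L.graph.Preconnected) {x y z : S} {H : ℝ} (hxy : L.height x y ≤ H)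
    (hyz : L.height y z ≤ H) : L.height x z ≤ H :=
  (height_le_iff hc).2 (((height_le_iff hc).1 hxy).trans ((height_le_iff hc).1 hyz))

/-- The ultrametric inequality. When one term on the right is too small, it forces the other to
dominate; most comparisons below have this form. -/
theorem height_le_max (hc : L.graph.Preconnected) (x y z : S) :
    L.height x z ≤ max (L.height x y) (L.height y z) :=
  height_le_trans hc (le_max_left _ _) (le_max_right _ _)

theorem height_lt_of_joinedWithin (hc : L.graph.Preconnected) {x y : S} {H : ℝ}
    (h : L.JoinedWithin {v | L.energy v < H} x y) : L.height x y < H := by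
  obtain ⟨w, hw⟩ := h
  obtain ⟨t, ht, he⟩ := exists_energy_eq_peak w
  exact ((height_le_iff hc).2 ⟨w, fun v hv => le_peak w hv⟩).trans_lt (he ▸ hw t ht)

theorem energy_le_height (hc : L.graph.Preconnected) (x y : S) : L.energy x ≤ L.height x y :=
  (joinedWithin_height hc x y).left_mem

theorem height_self (hc : L.graph.Preconnected) (x : S) : L.height x x = L.energy x :=
  le_antisymm ((height_le_iff hc).2 (.refl (le_refl (L.energy x)))) (energy_le_height hc x x)

theorem exists_isMinimalPath_of_joinedWithin (hc : L.graph.Preconnected) {A : Set S} {x y : S}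
    (h : L.JoinedWithin ({v | L.energy v ≤ L.height x y} ∩ A) x y) :
    ∃ w : L.graph.Walk x y, L.IsMinimalPath w ∧ ∀ v ∈ w.support, v ∈ A := by
  classical
  obtain ⟨w, hw⟩ := h
  have hsub := fun v (hv : v ∈ w.bypass.support) => hw v (w.support_bypass_subset_support hv)
  refine ⟨w.bypass, ⟨w.bypass_isPath, fun w' hw' => ?_⟩, fun v hv => (hsub v hv).2⟩
  refine (peak_le _ fun v hv => (hsub v hv).1).trans ?_
  exact (height_le_iff hc).2 ⟨w', fun v hv => le_peak w' hv⟩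

end Finite

end EnergyLandscape

namespace EnergyLandscape

variable {S : Type*} {L : EnergyLandscape S}

/-- A walk towards a point of `U` has a first vertex in `U`. -/
theorem JoinedWithin.exists_first_hit {A : Set S} {x y : S} (h : L.JoinedWithin A x y) {U : Set S}
    (hy : y ∈ U) :
    ∃ p ∈ U, L.JoinedWithin (A ∩ (Uᶜ ∪ {p})) x p ∧ L.JoinedWithin A p y := by
  by_cases hx : x ∈ U
  · exact ⟨x, hx, .refl ⟨h.left_mem, .inr rfl⟩, h⟩
  rcases h.inter_or_exit Uᶜ hx with h | ⟨q, p, hq, hqp, hpA, hpU, hpy⟩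
  · exact absurd hy h.right_mem.2
  refine ⟨p, not_not.1 hpU, ?_, hpy⟩
  have hsub : A ∩ Uᶜ ⊆ A ∩ (Uᶜ ∪ {p}) := fun v hv => ⟨hv.1, .inl hv.2⟩
  exact (hq.mono hsub).trans (.of_adj (hsub hq.right_mem) ⟨hpA, .inr rfl⟩ hqp)

/-- Each vertex of the walk is reached by an initial piece of it. This confines a walk to the
component of its starting point. -/
theorem JoinedWithin.inter_joinedWithin {A : Set S} {x y : S} (h : L.JoinedWithin A x y) :
    L.JoinedWithin (A ∩ {v | L.JoinedWithin A x v}) x y := by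
  classical
  obtain ⟨w, hw⟩ := h
  exact ⟨w, fun v hv => ⟨hw v hv, w.takeUntil v hv,
    fun u hu => hw u (w.support_takeUntil_subset_support hv hu)⟩⟩

/-! ### Minima and metastable sets -/

theorem metastable_anti {k i : ℕ} (h : k ≤ i) : L.metastable i ⊆ L.metastable k :=
  Set.image_mono (Set.Icc_subset_Icc_left h)

theorem energy_lt_of_adj_minimum {j : ℕ} (hj : j ∈ Set.Icc 1 L.numMinima) {r : S}
    (h : L.graph.Adj (L.minimum j) r) : L.energy (L.minimum j) < L.energy r :=
  L.minimum_bijOn.mapsTo hj r h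

theorem exists_minimum_eq {i : ℕ} (hi : 1 ≤ i) {m : S} (hm : m ∈ L.metastable i) :
    ∃ j, i ≤ j ∧ j ∈ Set.Icc 1 L.numMinima ∧ L.minimum j = m := by
  obtain ⟨j, hj, rfl⟩ := hm
  exact ⟨j, hj.1, ⟨hi.trans hj.1, hj.2⟩, rfl⟩

theorem Attracted.height_le {i : ℕ} {s m m' : S} (h : L.Attracted i s m)
    (hm' : m' ∈ L.metastable i) : L.height s m ≤ L.height s m' := h.2.1 m' hm'

theorem attracted_of_mem_innerValley {i : ℕ} {s m : S} (hm : m ∈ L.metastable i)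
    (hs : s ∈ L.innerValley i m) : L.Attracted i s m := by
  refine ⟨hm, fun m' hm' => ?_, fun m' hm' hne h => absurd h (hs m' hm' hne).ne'⟩
  rcases eq_or_ne m' m with rfl | hne
  exacts [le_rfl, (hs m' hm' hne).le]

variable [Finite S]

/-- The first step out of a local minimum goes uphill. -/
theorem energy_minimum_lt_height (hc : L.graph.Preconnected) {j : ℕ}
    (hj : j ∈ Set.Icc 1 L.numMinima) {y : S} (hy : L.minimum j ≠ y) :
    L.energy (L.minimum j) < L.height (L.minimum j) y := by
  obtain ⟨w, hw⟩ := joinedWithin_height hc (L.minimum j) y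
  cases w with
  | nil => exact absurd rfl hy
  | cons h w => exact (energy_lt_of_adj_minimum hj h).trans_le (hw _ (by simp))

theorem mem_innerValley_self (hc : L.graph.Preconnected) {i : ℕ} (hi : 1 ≤ i) {m : S}
    (hm : m ∈ L.metastable i) : m ∈ L.innerValley i m := by
  intro m' _ hne
  obtain ⟨j, -, hj, rfl⟩ := exists_minimum_eq hi hm
  change L.height _ _ < L.height _ _
  rw [height_self hc]
  exact energy_minimum_lt_height hc hj hne.symm

/-- The inner valley of `m` contains everything that its members reach at least as easily as `m`. -/
theorem mem_innerValley_of_height_le (hc : L.graph.Preconnected) {i : ℕ} {m x y : S}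
    (hx : x ∈ L.innerValley i m) (h : L.height x y ≤ L.height x m) : y ∈ L.innerValley i m := by
  intro m' hm' hne
  have h1 : L.height x m < L.height x m' := hx m' hm' hne
  have h2 : L.height y m ≤ L.height x m := height_le_trans hc (height_comm hc x y ▸ h) le_rfl
  have h3 := height_le_max hc x y m'
  change L.height y m < L.height y m'
  rcases le_max_iff.1 h3 with h3 | h3 <;> linarith

/-! ### Attraction -/

/-- A walk to `m'` within the sublevel set of `height s m` forces equality of heights by minimality,
so the condition on all minimal paths becomes the absence of a single low walk avoiding the inner
valley. -/
theorem attracted_iff (hc : L.graph.Preconnected) {i : ℕ} {s m : S} :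
    L.Attracted i s m ↔ m ∈ L.metastable i ∧
      (∀ m' ∈ L.metastable i, L.height s m ≤ L.height s m') ∧
      ∀ m' ∈ L.metastable i, m' ≠ m →
        ¬ L.JoinedWithin ({v | L.energy v ≤ L.height s m} ∩ (L.innerValley i m)ᶜ) s m' := by
  refine and_congr_right fun _ => and_congr_right fun hmin => forall₃_congr fun m' hm' hne => ?_
  constructor
  · intro h hJ
    have heq : L.height s m' = L.height s m :=
      le_antisymm ((height_le_iff hc).2 (hJ.mono Set.inter_subset_left)) (hmin m' hm')
    obtain ⟨w, hw, hav⟩ := exists_isMinimalPath_of_joinedWithin hc (heq ▸ hJ)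
    obtain ⟨t, ht, htv⟩ := h heq w hw
    exact hav t ht htv
  · intro h heq w hw
    by_contra! hav
    have he : L.height s m' = L.height s m := heq
    refine h ⟨w, fun v hv => ⟨?_, hav v hv⟩⟩
    exact (le_peak w hv).trans ((peak_eq_height hc hw).trans he).le

theorem attracted_self (hc : L.graph.Preconnected) {i : ℕ} (hi : 1 ≤ i) {m : S}
    (hm : m ∈ L.metastable i) : L.Attracted i m m :=
  attracted_of_mem_innerValley hm (mem_innerValley_self hc hi hm)

/-- Attraction by `m` persists along walks that are not higher than the way to `m` and avoid the
inner valley of `m`. -/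
theorem Attracted.of_joinedWithin (hc : L.graph.Preconnected) {i : ℕ} {x y m : S}
    (hx : L.Attracted i x m)
    (h : L.JoinedWithin ({v | L.energy v ≤ L.height x m} ∩ (L.innerValley i m)ᶜ) x y) :
    L.Attracted i y m := by
  have hx' := (attracted_iff hc).1 hx
  have hxy : L.height x y ≤ L.height x m := (height_le_iff hc).2 (h.mono Set.inter_subset_left)
  have hyx : L.height y x ≤ L.height x m := height_comm hc x y ▸ hxy
  have hym : L.height y m ≤ L.height x m := height_le_trans hc hyx le_rfl
  -- Preceded by the walk from `x` to `y`, such a walk would contradict the attraction of `x`.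
  have key : ∀ m' ∈ L.metastable i, m' ≠ m → ∀ H ≤ L.height x m,
      ¬ L.JoinedWithin ({v | L.energy v ≤ H} ∩ (L.innerValley i m)ᶜ) y m' :=
    fun m' hm' hne H hH hJ => hx'.2.2 m' hm' hne
      (h.trans (hJ.mono (Set.inter_subset_inter_left _ fun _ hv => le_trans hv hH)))
  refine (attracted_iff hc).2 ⟨hx.1, fun m' hm' => ?_, fun m' hm' hne => key m' hm' hne _ hym⟩
  rcases eq_or_ne m' m with rfl | hne
  · exact le_rfl
  -- A strictly lower walk from `y` to `m'` either avoids the inner valley, against `key`, or enters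
  -- it at some `p`; there `m` is cheaper than `m'`, so `m` would be at least as easy to reach from
  -- `y`.
  by_contra! hlt
  have hJ := joinedWithin_height hc y m'
  rcases hJ.inter_or_exit _ h.right_mem.2 with hJ' | ⟨q, p, hq, hqp, hpA, hpB, hpm⟩
  · exact key m' hm' hne _ (hlt.le.trans hym) hJ'
  · have hp : p ∈ L.innerValley i m := not_not.1 hpB
    have h1 : L.height p m < L.height p m' := hp m' hm' hne
    have h2 : L.height p m' ≤ L.height y m' := (height_le_iff hc).2 hpm
    have h3 : L.height y p ≤ L.height y m' :=
      (height_le_iff hc).2 ((hq.mono Set.inter_subset_left).trans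
        (.of_adj hq.right_mem.1 hpA hqp))
    exact hlt.not_ge (height_le_trans hc h3 (h1.le.trans h2))

/-- If `s` is attracted by `n` and, at a later level, by `m`, then `n` is attracted by `m`. -/
theorem Attracted.attracted (hc : L.graph.Preconnected) {k i : ℕ} (hk : 1 ≤ k) (hki : k ≤ i)
    {s n m : S} (hn : L.Attracted k s n) (hm : L.Attracted i s m) : L.Attracted i n m := by
  by_cases hnm : n ∈ L.innerValley i m
  · exact attracted_of_mem_innerValley hm.1 hnm
  have hmk : m ∈ L.metastable k := metastable_anti hki hm.1
  have hle : L.height s n ≤ L.height s m := hn.height_le hmk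
  -- The case distinction is on which of the two inner valleys is met first on the way from `s` to
  -- `n`.
  obtain ⟨p, hp, hsp, hpn⟩ := (joinedWithin_height hc s n).exists_first_hit
    (U := L.innerValley i m ∪ L.innerValley k n) (.inr (mem_innerValley_self hc hk hn.1))
  have hsp' : L.height s p ≤ L.height s n := (height_le_iff hc).2 (hsp.mono Set.inter_subset_left)
  have hpn' : L.height p n ≤ L.height s n := (height_le_iff hc).2 hpn
  by_cases hpm : p ∈ L.innerValley i m
  -- Here it suffices that `p` reaches `n` as easily as `m`, since `n` would then lie in the inner
  -- valley of `m`.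
  · refine absurd (mem_innerValley_of_height_le hc hpm ?_) hnm
    rcases hle.lt_or_eq with hlt | heq
    · rcases le_max_iff.1 (height_le_max hc s p m) with h | h <;> linarith
    · have hmn : m ≠ n := by
        rintro rfl
        exact hnm (mem_innerValley_self hc (hk.trans hki) hm.1)
      have hpm' : L.height p m ≤ L.height s m :=
        height_le_trans hc ((height_comm hc p s).le.trans (hsp'.trans hle)) le_rfl
      -- With equal heights, a minimal walk from `p` to `m` must meet the inner valley of `n`:
      -- otherwise `s` would reach `m` at the same height while avoiding it, against the attraction
      -- by `n`. At the meeting point `u`, `n` is cheaper than `m`.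
      obtain ⟨u, hu, hpu, hum⟩ : ∃ u ∈ L.innerValley k n,
          L.height p u ≤ L.height p m ∧ L.height u m ≤ L.height p m := by
        by_cases hpk : p ∈ L.innerValley k n
        · exact ⟨p, hpk, (height_self hc p).trans_le (energy_le_height hc p m), le_rfl⟩
        rcases (joinedWithin_height hc p m).inter_or_exit (L.innerValley k n)ᶜ hpk with
          hJ | ⟨q, u, hq, hqu, huA, hu, hum⟩
        · refine absurd ?_ (((attracted_iff hc).1 hn).2.2 m hmk hmn)
          refine (hsp.mono ?_).trans (hJ.mono ?_)
          · rintro v ⟨hv, hv' | rfl⟩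
            exacts [⟨hv, fun h => hv' (.inr h)⟩, ⟨hv, hpk⟩]
          · rintro v ⟨hv, hv'⟩
            exact ⟨le_trans hv (heq ▸ hpm'), hv'⟩
        · exact ⟨u, not_not.1 hu, (height_le_iff hc).2 ((hq.mono Set.inter_subset_left).trans
            (.of_adj hq.right_mem.1 huA hqu)), (height_le_iff hc).2 hum⟩
      have hun : L.height u n < L.height u m := hu m hmk hmn
      exact height_le_trans hc hpu (hun.le.trans hum)
  · have hpk : p ∈ L.innerValley k n := hp.resolve_left hpm
    -- If the rest of the walk to `n` avoids the inner valley of `m`, attraction by `m` is carried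
    -- from `s` to `n`. If it enters at `t`, then `height p n < height p m` places `n` in that inner
    -- valley.
    rcases (joinedWithin_height hc p n).inter_or_exit (L.innerValley i m)ᶜ hpm with
      hJ | ⟨q, t, hq, hqt, htA, ht, htn⟩
    · refine hm.of_joinedWithin hc ((hsp.mono ?_).trans (hJ.mono ?_))
      · rintro v ⟨hv, hv' | rfl⟩
        exacts [⟨le_trans hv hle, fun h => hv' (.inl h)⟩, ⟨le_trans hv hle, hpm⟩]
      · rintro v ⟨hv, hv'⟩
        exact ⟨le_trans hv (hpn'.trans hle), hv'⟩
    · have hmn : m ≠ n := by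
        rintro rfl
        exact hnm (mem_innerValley_self hc (hk.trans hki) hm.1)
      refine absurd (mem_innerValley_of_height_le hc (not_not.1 ht) ?_) hnm
      have h1 : L.height p t ≤ L.height p n := (height_le_iff hc).2
        ((hq.mono Set.inter_subset_left).trans (.of_adj hq.right_mem.1 htA hqt))
      have h2 : L.height t n ≤ L.height p n := (height_le_iff hc).2 htn
      have h3 : L.height p n < L.height p m := hpk m hmk hmn
      rcases le_max_iff.1 (height_le_max hc p t m) with h | h <;> linarith

/-- A minimum of `M⁽ⁱ⁾` is attracted only by itself. -/
theorem Attracted.eq_of_mem (hc : L.graph.Preconnected) {i : ℕ} (hi : 1 ≤ i) {n m : S}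
    (hn : n ∈ L.metastable i) (h : L.Attracted i n m) : n = m := by
  by_contra hne
  obtain ⟨j, -, hj, rfl⟩ := exists_minimum_eq hi hn
  have := energy_minimum_lt_height hc hj hne
  have h2 := h.height_le hn
  rw [height_self hc] at h2
  linarith

theorem Attracted.unique (hc : L.graph.Preconnected) {i : ℕ} (hi : 1 ≤ i) {s n m : S}
    (hn : L.Attracted i s n) (hm : L.Attracted i s m) : n = m :=
  (hn.attracted hc hi le_rfl hm).eq_of_mem hc hi hn.1

/-- An attracted state is joined to its attractor within the attracted states, along a minimal
path. -/
theorem Attracted.joinedWithin (hc : L.graph.Preconnected) {i : ℕ} (hi : 1 ≤ i) {x m : S}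
    (h : L.Attracted i x m) :
    L.JoinedWithin ({s | L.Attracted i s m} ∩ {v | L.energy v ≤ L.height x m}) x m := by
  -- A minimal walk started in the inner valley remains there; outside it, attraction is carried
  -- along until the inner valley is entered.
  have inner : ∀ p ∈ L.innerValley i m, L.height p m ≤ L.height x m →
      L.JoinedWithin ({s | L.Attracted i s m} ∩ {v | L.energy v ≤ L.height x m}) p m := by
    intro p hp hle
    refine (joinedWithin_height hc p m).inter_joinedWithin.mono ?_
    rintro v ⟨hv, hpv⟩
    exact ⟨attracted_of_mem_innerValley h.1
      (mem_innerValley_of_height_le hc hp ((height_le_iff hc).2 hpv)), le_trans hv hle⟩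
  by_cases hx : x ∈ L.innerValley i m
  · exact inner x hx le_rfl
  rcases (joinedWithin_height hc x m).inter_or_exit (L.innerValley i m)ᶜ hx with
    hJ | ⟨q, p, hq, hqp, hpA, hp, hpm⟩
  · exact absurd (mem_innerValley_self hc hi h.1) hJ.right_mem.2
  have hJ : L.JoinedWithin ({s | L.Attracted i s m} ∩ {v | L.energy v ≤ L.height x m}) x q :=
    hq.inter_joinedWithin.mono (by
      rintro v ⟨hv, hqv⟩
      exact ⟨h.of_joinedWithin hc hqv, hv.1⟩)
  exact hJ.trans (.cons hJ.right_mem hqp (inner p (not_not.1 hp) ((height_le_iff hc).2 hpm)))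

/-- A neighbour no higher than the way to `m` would inherit attraction, either through the inner
valley or by extending a walk that avoids it. -/
theorem Attracted.height_lt_energy (hc : L.graph.Preconnected) {i : ℕ} {x y m : S}
    (h : L.Attracted i x m) (hy : ¬ L.Attracted i y m) (hxy : L.graph.Adj x y) :
    L.height x m < L.energy y := by
  by_contra! hle
  have hyV : y ∉ L.innerValley i m := fun h' => hy (attracted_of_mem_innerValley h.1 h')
  have hx := energy_le_height hc x m
  by_cases hxV : x ∈ L.innerValley i m
  · exact hyV (mem_innerValley_of_height_le hc hxV
      ((height_le_iff hc).2 (.of_adj hx hle hxy)))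
  · exact hy (h.of_joinedWithin hc (.of_adj ⟨hx, hxV⟩ ⟨hle, hyV⟩ hxy))

end EnergyLandscape

namespace EnergyLandscape

variable {S : Type*} {L : EnergyLandscape S}

/-! ### Merge levels -/

theorem lt_mergeLevel (L : EnergyLandscape S) (j : ℕ) : (j : ℕ∞) < L.mergeLevel j := by
  have h : ((j + 1 : ℕ) : ℕ∞) ≤ L.mergeLevel j := by
    refine le_sInf ?_
    rintro _ ⟨k, rfl, hjk, -⟩
    exact_mod_cast hjk
  exact lt_of_lt_of_le (by exact_mod_cast j.lt_succ_self) h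

theorem mergeLevel_le {j i : ℕ} (hji : j < i) (hi : i ≤ L.numMinima) {m : S}
    (h : L.Attracted i (L.minimum j) m) : L.mergeLevel j ≤ i :=
  sInf_le ⟨i, rfl, hji, hi, m, h.1, h⟩

theorem exists_attracted_of_mergeLevel_eq {j i : ℕ} (h : L.mergeLevel j = i) :
    j < i ∧ ∃ m, L.Attracted i (L.minimum j) m := by
  have hne : {k : ℕ∞ | ∃ k' : ℕ, k = k' ∧ j < k' ∧ k' ≤ L.numMinima ∧
      ∃ m ∈ L.metastable k', L.Attracted k' (L.minimum j) m}.Nonempty := by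
    by_contra hempty
    rw [Set.not_nonempty_iff_eq_empty] at hempty
    rw [mergeLevel, hempty, sInf_empty] at h
    exact ENat.natCast_ne_top i h.symm
  obtain ⟨k, hk, hjk, -, m, -, hm⟩ := csInf_mem hne
  obtain rfl : k = i := by
    have : (k : ℕ∞) = i := hk.symm.trans h
    exact_mod_cast this
  exact ⟨hjk, m, hm⟩

/-! ### Valleys -/

theorem mem_valleyOrder_succ {i j : ℕ} {s : S} : s ∈ L.valleyOrder (i + 1) j ↔
    s ∈ L.valleyOrder i j ∨ i + 1 ≤ j ∧
      (((∀ k ∈ Set.Icc 1 L.numMinima, s ∉ L.valleyOrder i k) ∧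
        L.Attracted (i + 1) s (L.minimum j)) ∨
      ∃ k, 1 ≤ k ∧ k < i + 1 ∧ L.mergeLevel k = ((i + 1 : ℕ) : ℕ∞) ∧
        L.Attracted (i + 1) (L.minimum k) (L.minimum j) ∧ s ∈ L.valleyOrder i k) := by
  rw [valleyOrder]
  split_ifs with h
  · simp [Nat.not_le.2 h]
  · simp only [Set.mem_union, Set.mem_ofPred_eq, Set.mem_iUnion, exists_prop, and_assoc,
      Nat.not_lt.1 h, true_and, or_assoc]

theorem valleyOrder_mono {i i' : ℕ} (h : i ≤ i') (j : ℕ) :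
    L.valleyOrder i j ⊆ L.valleyOrder i' j := by
  induction i', h using Nat.le_induction with
  | base => exact subset_rfl
  | succ k _ ih => exact ih.trans fun s hs => mem_valleyOrder_succ.2 (.inl hs)

theorem valleyOrder_succ_of_lt {i j : ℕ} (h : j < i + 1) :
    L.valleyOrder (i + 1) j = L.valleyOrder i j := by
  rw [valleyOrder, if_pos h]

variable [Finite S]

/-- If a state of the valley of `m⁽ʲ⁾` is attracted by `m`, then so is `m⁽ʲ⁾`. -/
theorem attracted_minimum_of_mem_valleyOrder (hc : L.graph.Preconnected) {k i j : ℕ} (hki : k ≤ i)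
    {s m : S} (hs : s ∈ L.valleyOrder k j) (hm : L.Attracted i s m) :
    L.Attracted i (L.minimum j) m := by
  induction k generalizing j with
  | zero => exact hs.elim
  | succ k ih =>
    rcases mem_valleyOrder_succ.1 hs with hs | ⟨-, ⟨-, hs⟩ | ⟨k', -, -, -, hk', hs⟩⟩
    · exact ih (by lia) hs
    · exact hs.attracted hc (by lia) hki hm
    · exact hk'.attracted hc (by lia) hki (ih (by lia) hs)

-- Absorbed valleys persist under their old indices, so an assigned state must be traced to a valley
-- that is still alive. An absorbing minimum at level `i` has index at least `i`, and its merge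
-- level is larger still.
omit [Finite S] in
theorem exists_mem_valleyOrder_of_lt_mergeLevel {i j : ℕ} (hj : j ∈ Set.Icc 1 L.numMinima) {s : S}
    (hs : s ∈ L.valleyOrder i j) :
    ∃ k ∈ Set.Icc 1 L.numMinima, (i : ℕ∞) < L.mergeLevel k ∧ s ∈ L.valleyOrder i k := by
  induction i generalizing j with
  | zero => exact hs.elim
  | succ i ih =>
    by_cases hex : ∃ k ∈ Set.Icc 1 L.numMinima, s ∈ L.valleyOrder i k
    · obtain ⟨k₀, hk₀, hs₀⟩ := hex
      obtain ⟨k, hk, hlk, hsk⟩ := ih hk₀ hs₀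
      rcases (Order.add_one_le_of_lt hlk).lt_or_eq with hlt | heq
      · exact ⟨k, hk, by exact_mod_cast hlt, valleyOrder_mono i.le_succ k hsk⟩
      · have heq' : L.mergeLevel k = ((i + 1 : ℕ) : ℕ∞) := by exact_mod_cast heq.symm
        obtain ⟨hki, m, hm⟩ := exists_attracted_of_mergeLevel_eq heq'
        obtain ⟨l, hil, hl, rfl⟩ := exists_minimum_eq (by lia) hm.1
        refine ⟨l, hl, lt_of_le_of_lt (by exact_mod_cast hil) (L.lt_mergeLevel l), ?_⟩
        exact mem_valleyOrder_succ.2 (.inr ⟨hil, .inr ⟨k, hk.1, hki, heq', hm, hsk⟩⟩)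
    · push Not at hex
      rcases mem_valleyOrder_succ.1 hs with hs' | ⟨hij, -⟩
      · exact absurd hs' (hex j hj)
      · exact ⟨j, hj, lt_of_le_of_lt (by exact_mod_cast hij) (L.lt_mergeLevel j), hs⟩

omit [Finite S] in
theorem minimum_mem_metastable {i j : ℕ} (hij : i ≤ j) (hj : j ∈ Set.Icc 1 L.numMinima) :
    L.minimum j ∈ L.metastable i := ⟨j, ⟨hij, hj.2⟩, rfl⟩

/-- The valleys of distinct metastates are disjoint. -/
theorem eq_of_mem_valleyOrder (hc : L.graph.Preconnected) {i j j' : ℕ}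
    (hj : j ∈ Set.Icc 1 L.numMinima) (hj' : j' ∈ Set.Icc 1 L.numMinima)
    (hlj : (i : ℕ∞) < L.mergeLevel j) (hlj' : (i : ℕ∞) < L.mergeLevel j') {s : S}
    (hs : s ∈ L.valleyOrder i j) (hs' : s ∈ L.valleyOrder i j') : j = j' := by
  induction i generalizing j j' with
  | zero => exact hs.elim
  | succ i ih =>
    have hlt : (i : ℕ∞) < ((i + 1 : ℕ) : ℕ∞) := by exact_mod_cast i.lt_succ_self
    -- A state of a living valley is either newly assigned, or comes from a valley alive one level
    -- earlier which is the same one or merges into it now. The induction hypothesis identifies the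
    -- earlier valleys, and uniqueness of attractors does the rest.
    have old : ∀ {j}, j ∈ Set.Icc 1 L.numMinima → ((i + 1 : ℕ) : ℕ∞) < L.mergeLevel j →
        s ∈ L.valleyOrder (i + 1) j →
        ((∀ k ∈ Set.Icc 1 L.numMinima, s ∉ L.valleyOrder i k) ∧
          L.Attracted (i + 1) s (L.minimum j)) ∨
        ∃ k ∈ Set.Icc 1 L.numMinima, s ∈ L.valleyOrder i k ∧ (i : ℕ∞) < L.mergeLevel k ∧
          (k = j ∨ L.mergeLevel k = ((i + 1 : ℕ) : ℕ∞) ∧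
            L.Attracted (i + 1) (L.minimum k) (L.minimum j)) := by
      intro j hj hlj hs
      rcases mem_valleyOrder_succ.1 hs with hs | ⟨hij, hs | ⟨k, hk, hki, hlk, hatt, hs⟩⟩
      · exact .inr ⟨j, hj, hs, hlt.trans hlj, .inl rfl⟩
      · exact .inl hs
      · exact .inr ⟨k, ⟨hk, by have := hj.2; lia⟩, hs, hlk ▸ hlt, .inr ⟨hlk, hatt⟩⟩
    rcases old hj hlj hs with ⟨hn, ha⟩ | ⟨k, hk, hsk, hlk, hor⟩ <;>
      rcases old hj' hlj' hs' with ⟨hn', ha'⟩ | ⟨k', hk', hsk', hlk', hor'⟩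
    · exact L.minimum_bijOn.injOn hj hj' (ha.unique hc (by lia) ha')
    · exact absurd hsk' (hn k' hk')
    · exact absurd hsk (hn' k hk)
    · obtain rfl := ih hk hk' hlk hlk' hsk hsk'
      rcases hor with rfl | ⟨heq, ha⟩ <;> rcases hor' with h | ⟨heq', ha'⟩
      · exact h
      · exact absurd heq' hlj.ne'
      · exact absurd (h ▸ heq) hlj'.ne'
      · exact L.minimum_bijOn.injOn hj hj' (ha.unique hc (by lia) ha')

/-- The states attracted by `m⁽ʲ⁾` at level `i ≤ j` belong to the valley of `m⁽ʲ⁾`. -/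
theorem Attracted.mem_valleyOrder (hc : L.graph.Preconnected) {i j : ℕ} (hij : i + 1 ≤ j)
    (hj : j ∈ Set.Icc 1 L.numMinima) {s : S} (h : L.Attracted (i + 1) s (L.minimum j)) :
    s ∈ L.valleyOrder (i + 1) j := by
  refine mem_valleyOrder_succ.2 ?_
  by_cases hex : ∃ k ∈ Set.Icc 1 L.numMinima, s ∈ L.valleyOrder i k
  · obtain ⟨k₀, hk₀, hs₀⟩ := hex
    obtain ⟨k, hk, hlk, hs⟩ := exists_mem_valleyOrder_of_lt_mergeLevel hk₀ hs₀
    -- The minimum of the valley already containing `s` inherits the attraction. If it has left the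
    -- metastable set, its valley is absorbed now; otherwise it attracts itself and must be `m⁽ʲ⁾`.
    have ha := attracted_minimum_of_mem_valleyOrder hc i.le_succ hs h
    rcases Nat.lt_or_ge k (i + 1) with hki | hki
    · refine .inr ⟨hij, .inr ⟨k, hk.1, hki, le_antisymm ?_ ?_, ha, hs⟩⟩
      · exact mergeLevel_le hki (hij.trans hj.2) ha
      · exact_mod_cast Order.add_one_le_of_lt hlk
    · have := ha.eq_of_mem hc (by lia) (minimum_mem_metastable hki hk)
      exact .inl (L.minimum_bijOn.injOn hk hj this ▸ hs)
  · push Not at hex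
    exact .inr ⟨hij, .inl ⟨hex, h⟩⟩

theorem minimum_mem_valleyOrder (hc : L.graph.Preconnected) {i j : ℕ} (hi : 1 ≤ i)
    (hj : j ∈ Set.Icc 1 L.numMinima) : L.minimum j ∈ L.valleyOrder i j :=
  valleyOrder_mono hi j
    ((attracted_self hc le_rfl (minimum_mem_metastable hj.1 hj)).mem_valleyOrder hc hj.1 hj)

/-- A state outside a valley which is adjacent to a state `x` of the valley is higher than some way
from `x` to the minimum inside the valley. -/
theorem joinedWithin_valleyOrder (hc : L.graph.Preconnected) {i j : ℕ}
    (hj : j ∈ Set.Icc 1 L.numMinima) {x y : S} (hx : x ∈ L.valleyOrder i j)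
    (hy : y ∉ L.valleyOrder i j) (hxy : L.graph.Adj x y) :
    L.JoinedWithin (L.valleyOrder i j ∩ {v | L.energy v < L.energy y}) x (L.minimum j) := by
  induction i generalizing j x with
  | zero => exact hx.elim
  | succ i ih =>
    have hyi : ∀ j, L.valleyOrder i j ⊆ L.valleyOrder (i + 1) j := valleyOrder_mono i.le_succ
    rcases Nat.lt_or_ge j (i + 1) with hij | hij
    · rw [valleyOrder_succ_of_lt hij] at hx hy ⊢
      exact ih hj hx hy hxy
    have hA : ∀ {s}, L.Attracted (i + 1) s (L.minimum j) → s ∈ L.valleyOrder (i + 1) j :=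
      fun h => h.mem_valleyOrder hc hij hj
    have hyA : ¬ L.Attracted (i + 1) y (L.minimum j) := fun h => hy (hA h)
    have hJA : ∀ {s}, L.Attracted (i + 1) s (L.minimum j) →
        L.height s (L.minimum j) < L.energy y →
        L.JoinedWithin (L.valleyOrder (i + 1) j ∩ {v | L.energy v < L.energy y}) s
          (L.minimum j) :=
      fun h hlt => (h.joinedWithin hc (by lia)).mono
        (Set.inter_subset_inter (fun _ hv => hA hv) fun _ hv => lt_of_le_of_lt hv hlt)
    rcases mem_valleyOrder_succ.1 hx with hx | ⟨-, ⟨-, hx⟩ | ⟨k, hk, hki, hlk, hatt, hx⟩⟩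
    · exact (ih hj hx (fun h => hy (hyi j h)) hxy).mono (Set.inter_subset_inter_left _ (hyi j))
    · exact hJA hx (hx.height_lt_energy hc hyA hxy)
    · have hkV : L.valleyOrder i k ⊆ L.valleyOrder (i + 1) j := fun s hs =>
        mem_valleyOrder_succ.2 (.inr ⟨hij, .inr ⟨k, hk, hki, hlk, hatt, hs⟩⟩)
      have hk' : k ∈ Set.Icc 1 L.numMinima := ⟨hk, by have := hj.2; lia⟩
      have hJ := ih hk' hx (fun h => hy (hkV h)) hxy
      refine (hJ.mono (Set.inter_subset_inter_left _ hkV)).trans (hJA hatt ?_)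
      -- It remains to show that the absorbed minimum `n` reaches `m` below `y`. If not, the low
      -- walk from `n` to `x` followed by the step to `y` would make `y` attracted by `m`, or put
      -- `n` or `y` in the inner valley of `m`.
      by_contra! hle
      set n := L.minimum k
      set m := L.minimum j
      have hyV : y ∉ L.innerValley (i + 1) m :=
        fun h' => hyA (attracted_of_mem_innerValley hatt.1 h')
      have hJn : L.JoinedWithin {v | L.energy v < L.energy y} n x :=
        (hJ.mono Set.inter_subset_right).symm
      have hsub : {v | L.energy v < L.energy y} ⊆ {v | L.energy v ≤ L.height n m} :=
        fun v hv => (lt_of_lt_of_le hv hle).le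
      have hny : L.height n y ≤ L.height n m :=
        (height_le_iff hc).2 ((hJn.mono hsub).trans (.of_adj (hsub hJn.right_mem) hle hxy))
      by_cases hnV : n ∈ L.innerValley (i + 1) m
      · exact hyV (mem_innerValley_of_height_le hc hnV hny)
      rcases hJn.inter_or_exit (L.innerValley (i + 1) m)ᶜ hnV with
        hJ' | ⟨q, t, hq, hqt, htA, ht, -⟩
      · have hJ'' := hJ'.mono (Set.inter_subset_inter_left _ hsub)
        exact hyA (hatt.of_joinedWithin hc
          (hJ''.trans (.of_adj hJ''.right_mem ⟨hle, hyV⟩ hxy)))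
      · have hnt : L.height n t < L.energy y := height_lt_of_joinedWithin hc
          ((hq.mono Set.inter_subset_left).trans (.of_adj hq.right_mem.1 htA hqt))
        refine hnV (mem_innerValley_of_height_le hc (not_not.1 ht) ?_)
        rw [height_comm hc t n]
        rcases le_max_iff.1 (height_le_max hc n t m) with h | h <;> linarith

end EnergyLandscape

namespace EnergyLandscape

variable {S : Type*} {L : EnergyLandscape S}

/-! ### Metastates -/

theorem mem_nonassigned {i : ℕ} {s : S} :
    s ∈ L.nonassigned i ↔ ∀ j ∈ Set.Icc 1 L.numMinima, s ∉ L.valleyOrder i j := by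
  simp [nonassigned]

variable [Finite S]

theorem minimum_notMem_nonassigned (hc : L.graph.Preconnected) {i j : ℕ} (hi : 1 ≤ i)
    (hj : j ∈ Set.Icc 1 L.numMinima) : L.minimum j ∉ L.nonassigned i :=
  fun h => mem_nonassigned.1 h j hj (minimum_mem_valleyOrder hc hi hj)

theorem valley_minimum (hc : L.graph.Preconnected) {i j : ℕ} (hi : 1 ≤ i)
    (hj : j ∈ Set.Icc 1 L.numMinima) : L.valley i (L.minimum j) = L.valleyOrder i j := by
  ext x
  constructor
  · rintro (⟨k, hk, he, hx⟩ | ⟨h, -⟩)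
    · rwa [L.minimum_bijOn.injOn hj hk he]
    · exact absurd h (minimum_notMem_nonassigned hc hi hj)
  · exact fun hx => .inl ⟨j, hj, rfl, hx⟩

theorem valley_nonassigned (hc : L.graph.Preconnected) {i : ℕ} (hi : 1 ≤ i) {s : S}
    (hs : s ∈ L.nonassigned i) : L.valley i s = {s} := by
  ext x
  constructor
  · rintro (⟨k, hk, rfl, -⟩ | ⟨-, h⟩)
    · exact absurd hs (minimum_notMem_nonassigned hc hi hk)
    · exact h
  · exact fun hx => .inr ⟨hs, hx⟩

omit [Finite S] in
theorem exists_eq_minimum {i : ℕ} {s : S} (hs : s ∈ L.metastates i) (hN : s ∉ L.nonassigned i) :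
    ∃ j ∈ Set.Icc 1 L.numMinima, (i : ℕ∞) < L.mergeLevel j ∧ L.minimum j = s := by
  rcases hs with ⟨j, hj, hl, rfl⟩ | h
  exacts [⟨j, hj, hl, rfl⟩, absurd h hN]

theorem exists_mem_valley (hc : L.graph.Preconnected) {i : ℕ} (hi : 1 ≤ i) (x : S) :
    ∃ s ∈ L.metastates i, x ∈ L.valley i s := by
  by_cases hx : x ∈ L.nonassigned i
  · exact ⟨x, .inr hx, .inr ⟨hx, rfl⟩⟩
  · rw [mem_nonassigned] at hx
    push Not at hx
    obtain ⟨j, hj, hxj⟩ := hx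
    obtain ⟨k, hk, hl, hxk⟩ := exists_mem_valleyOrder_of_lt_mergeLevel hj hxj
    exact ⟨L.minimum k, .inl ⟨k, hk, hl, rfl⟩, by rwa [valley_minimum hc hi hk]⟩

/-- The valleys of the level `i` metastates are pairwise disjoint. -/
theorem eq_of_mem_valley (hc : L.graph.Preconnected) {i : ℕ} (hi : 1 ≤ i) {x r s : S}
    (hr : r ∈ L.metastates i) (hs : s ∈ L.metastates i) (hxr : x ∈ L.valley i r)
    (hxs : x ∈ L.valley i s) : r = s := by
  have aux : ∀ {r s}, r ∈ L.nonassigned i → s ∈ L.metastates i → x ∈ L.valley i r →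
      x ∈ L.valley i s → r = s := by
    intro r s hr hs hxr hxs
    rw [valley_nonassigned hc hi hr] at hxr
    obtain rfl : x = r := hxr
    by_cases hsN : s ∈ L.nonassigned i
    · rw [valley_nonassigned hc hi hsN] at hxs
      exact hxs
    · obtain ⟨j, hj, -, rfl⟩ := exists_eq_minimum hs hsN
      rw [valley_minimum hc hi hj] at hxs
      exact absurd hxs (mem_nonassigned.1 hr j hj)
  by_cases hrN : r ∈ L.nonassigned i
  · exact aux hrN hs hxr hxs
  by_cases hsN : s ∈ L.nonassigned i
  · exact (aux hsN hr hxs hxr).symm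
  obtain ⟨j, hj, hlj, rfl⟩ := exists_eq_minimum hr hrN
  obtain ⟨k, hk, hlk, rfl⟩ := exists_eq_minimum hs hsN
  rw [valley_minimum hc hi hj] at hxr
  rw [valley_minimum hc hi hk] at hxs
  rw [eq_of_mem_valleyOrder hc hj hk hlj hlk hxr hxs]

theorem metastateOf_eq_iff (hc : L.graph.Preconnected) {i : ℕ} (hi : 1 ≤ i) {x s : S}
    (hs : s ∈ L.metastates i) : L.metastateOf i x = s ↔ x ∈ L.valley i s := by
  have h := exists_mem_valley hc hi x
  obtain ⟨h1, h2⟩ := h.choose_spec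
  rw [metastateOf, dif_pos h]
  constructor
  · rintro rfl
    exact h2
  · exact fun h' => eq_of_mem_valley hc hi h1 hs h2 h'

theorem metastateOf_mem (hc : L.graph.Preconnected) {i : ℕ} (hi : 1 ≤ i) (x : S) :
    L.metastateOf i x ∈ L.metastates i := by
  have h := exists_mem_valley hc hi x
  rw [metastateOf, dif_pos h]
  exact h.choose_spec.1

/-- The valleys of distinct metastates are never adjacent. -/
theorem mem_nonassigned_of_adj (hc : L.graph.Preconnected) {i j : ℕ}
    (hj : j ∈ Set.Icc 1 L.numMinima) (hl : (i : ℕ∞) < L.mergeLevel j) {x y : S}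
    (hx : x ∈ L.valleyOrder i j) (hy : y ∉ L.valleyOrder i j) (hxy : L.graph.Adj x y) :
    y ∈ L.nonassigned i := by
  by_contra hN
  rw [mem_nonassigned] at hN
  push Not at hN
  obtain ⟨k₀, hk₀, hyk₀⟩ := hN
  obtain ⟨k, hk, hlk, hyk⟩ := exists_mem_valleyOrder_of_lt_mergeLevel hk₀ hyk₀
  have hxk : x ∉ L.valleyOrder i k := fun h =>
    hy (eq_of_mem_valleyOrder hc hj hk hl hlk hx h ▸ hyk)
  -- Each of the two adjacent states would be strictly higher than the other.
  have h1 := (joinedWithin_valleyOrder hc hj hx hy hxy).left_mem.2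
  have h2 := (joinedWithin_valleyOrder hc hk hyk hxk hxy.symm).left_mem.2
  exact lt_asymm (show L.energy x < L.energy y from h1) h2

/-- Since `i < numMinima`, there is a second living metastate; a walk to it must leave the valley,
so the outer boundary is nonempty and the dummy value is not used. -/
theorem exitState_spec (hc : L.graph.Preconnected) {i j : ℕ} (hi : 1 ≤ i)
    (hin : i < L.numMinima) (hj : j ∈ Set.Icc 1 L.numMinima)
    (hl : (i : ℕ∞) < L.mergeLevel j) :
    L.exitState i (L.minimum j) ∈ L.outerBoundary (L.valleyOrder i j) ∧
      ∀ y ∈ L.outerBoundary (L.valleyOrder i j),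
        L.energy (L.exitState i (L.minimum j)) ≤ L.energy y := by
  have hne : (L.outerBoundary (L.valley i (L.minimum j))).Nonempty := by
    rw [valley_minimum hc hi hj]
    -- The last minimum serves unless it is `m⁽ʲ⁾` itself; then `m⁽ⁱ⁾` does, as its merge level
    -- exceeds `i`.
    obtain ⟨k, hk, hlk, hkj⟩ : ∃ k ∈ Set.Icc 1 L.numMinima, (i : ℕ∞) < L.mergeLevel k ∧
        k ≠ j := by
      have hn : L.numMinima ∈ Set.Icc 1 L.numMinima := ⟨by lia, le_rfl⟩
      rcases eq_or_ne j L.numMinima with rfl | hjn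
      · exact ⟨i, ⟨hi, hin.le⟩, L.lt_mergeLevel i, hin.ne⟩
      · exact ⟨_, hn, lt_trans (by exact_mod_cast hin) (L.lt_mergeLevel _), hjn.symm⟩
    obtain ⟨w⟩ := hc (L.minimum j) (L.minimum k)
    have hJ : L.JoinedWithin Set.univ (L.minimum j) (L.minimum k) := ⟨w, fun _ _ => trivial⟩
    rcases hJ.inter_or_exit _ (minimum_mem_valleyOrder hc hi hj) with h | ⟨q, p, hq, hqp, -, hp, -⟩
    · exact absurd (eq_of_mem_valleyOrder hc hk hj hlk hl (minimum_mem_valleyOrder hc hi hk)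
        h.right_mem.2) hkj
    · exact ⟨p, hp, q, hq.right_mem.2, hqp⟩
  have h := Set.exists_min_image (L.outerBoundary (L.valley i (L.minimum j))) L.energy
    (Set.toFinite _) hne
  rw [exitState, dif_pos hne]
  have h' := h.choose_spec
  rwa [← valley_minimum hc hi hj]

theorem exitState_mem_nonassigned (hc : L.graph.Preconnected) {i j : ℕ} (hi : 1 ≤ i)
    (hin : i < L.numMinima) (hj : j ∈ Set.Icc 1 L.numMinima)
    (hl : (i : ℕ∞) < L.mergeLevel j) :
    L.exitState i (L.minimum j) ∈ L.nonassigned i := by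
  obtain ⟨hs, x, hx, hxs⟩ := (exitState_spec hc hi hin hj hl).1
  exact mem_nonassigned_of_adj hc hj hl hx hs hxs

end EnergyLandscape

/-! ### Hitting probabilities -/

section Hitting

variable {S : Type*} [Fintype S]

open Classical in
/-- The probability that the chain with transition matrix `P`, started at `x`, hits `T` within `N`
steps and before leaving `K ∪ T`. -/
noncomputable def hitWithin (P : Matrix S S ℝ) (K T : Set S) : ℕ → S → ℝ
  | 0, x => if x ∈ T then 1 else 0
  | N + 1, x => if x ∈ T then 1 else if x ∈ K then ∑ y, P x y * hitWithin P K T N y else 0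

/-- The probability that the chain with transition matrix `P`, started at `x`, hits `T` before
leaving `K ∪ T`. -/
noncomputable def hitProb (P : Matrix S S ℝ) (K T : Set S) (x : S) : ℝ :=
  ⨆ N, hitWithin P K T N x

/-- `P` is a stochastic matrix. -/
structure IsStochastic (P : Matrix S S ℝ) : Prop where
  nonneg : ∀ x y, 0 ≤ P x y
  row_sum : ∀ x, ∑ y, P x y = 1

variable {P : Matrix S S ℝ} {K T : Set S}

theorem hitWithin_of_mem {x : S} (hx : x ∈ T) (N : ℕ) : hitWithin P K T N x = 1 := by
  cases N <;> simp [hitWithin, hx]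

theorem hitWithin_succ {x : S} (hxT : x ∉ T) (hxK : x ∈ K) (N : ℕ) :
    hitWithin P K T (N + 1) x = ∑ y, P x y * hitWithin P K T N y := by
  simp [hitWithin, hxT, hxK]

theorem hitWithin_of_notMem {x : S} (hxT : x ∉ T) (hxK : x ∉ K) (N : ℕ) :
    hitWithin P K T N x = 0 := by
  cases N <;> simp [hitWithin, hxT, hxK]

theorem hitWithin_zero {x : S} (hxT : x ∉ T) : hitWithin P K T 0 x = 0 := by
  simp [hitWithin, hxT]

theorem hitWithin_nonneg (hP : IsStochastic P) (N : ℕ) (x : S) : 0 ≤ hitWithin P K T N x := by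
  induction N generalizing x with
  | zero => rw [hitWithin]; split_ifs <;> norm_num
  | succ N ih =>
    rw [hitWithin]
    split_ifs
    exacts [zero_le_one, Finset.sum_nonneg fun y _ => mul_nonneg (hP.nonneg x y) (ih y), le_rfl]

theorem IsStochastic.sum_mul_le (hP : IsStochastic P) {f : S → ℝ} {a : ℝ} (hf : ∀ y, f y ≤ a)
    (x : S) : ∑ y, P x y * f y ≤ a :=
  calc ∑ y, P x y * f y ≤ ∑ y, P x y * a :=
        Finset.sum_le_sum fun y _ => mul_le_mul_of_nonneg_left (hf y) (hP.nonneg x y)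
    _ = a := by rw [← Finset.sum_mul, hP.row_sum, one_mul]

/-- Hitting two disjoint sets are incompatible events. -/
theorem hitWithin_add_le_one (hP : IsStochastic P) {T' : Set S} (hT : Disjoint T T')
    (hK : Disjoint K T) (hK' : Disjoint K T') (N : ℕ) (x : S) :
    hitWithin P K T N x + hitWithin P K T' N x ≤ 1 := by
  induction N generalizing x with
  | zero =>
    by_cases h : x ∈ T
    · simp [hitWithin, h, hT.notMem_of_mem_left h]
    · simp only [hitWithin, h, if_false, zero_add]
      split_ifs <;> norm_num
  | succ N ih =>
    by_cases hx : x ∈ K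
    · rw [hitWithin_succ (hK.notMem_of_mem_left hx) hx,
        hitWithin_succ (hK'.notMem_of_mem_left hx) hx, ← Finset.sum_add_distrib]
      simp only [← mul_add]
      exact hP.sum_mul_le ih x
    · by_cases h : x ∈ T
      · rw [hitWithin_of_mem h, hitWithin_of_notMem (hT.notMem_of_mem_left h) hx, add_zero]
      · rw [hitWithin_of_notMem h hx, zero_add]
        by_cases h' : x ∈ T'
        · rw [hitWithin_of_mem h']
        · rw [hitWithin_of_notMem h' hx]
          exact zero_le_one

theorem hitWithin_le_one (hP : IsStochastic P) (N : ℕ) (x : S) : hitWithin P K T N x ≤ 1 := by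
  induction N generalizing x with
  | zero => rw [hitWithin]; split_ifs <;> norm_num
  | succ N ih =>
    rw [hitWithin]
    split_ifs
    exacts [le_rfl, hP.sum_mul_le ih x, zero_le_one]

theorem hitWithin_le_succ (hP : IsStochastic P) (N : ℕ) (x : S) :
    hitWithin P K T N x ≤ hitWithin P K T (N + 1) x := by
  induction N generalizing x with
  | zero =>
    by_cases hx : x ∈ T
    · rw [hitWithin_of_mem hx, hitWithin_of_mem hx]
    · exact hitWithin_zero (P := P) (K := K) hx ▸ hitWithin_nonneg hP 1 x
  | succ N ih =>
    by_cases hx : x ∈ T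
    · rw [hitWithin_of_mem hx, hitWithin_of_mem hx]
    by_cases hxK : x ∈ K
    · rw [hitWithin_succ hx hxK, hitWithin_succ hx hxK]
      exact Finset.sum_le_sum fun y _ => mul_le_mul_of_nonneg_left (ih y) (hP.nonneg x y)
    · rw [hitWithin_of_notMem hx hxK, hitWithin_of_notMem hx hxK]

theorem monotone_hitWithin (hP : IsStochastic P) (x : S) :
    Monotone fun N => hitWithin P K T N x :=
  monotone_nat_of_le_succ fun N => hitWithin_le_succ hP N x

theorem bddAbove_hitWithin (hP : IsStochastic P) (x : S) :
    BddAbove (Set.range fun N => hitWithin P K T N x) :=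
  ⟨1, by rintro _ ⟨N, rfl⟩; exact hitWithin_le_one hP N x⟩

theorem tendsto_hitWithin (hP : IsStochastic P) (x : S) :
    Tendsto (fun N => hitWithin P K T N x) atTop (𝓝 (hitProb P K T x)) :=
  tendsto_atTop_ciSup (monotone_hitWithin hP x) (bddAbove_hitWithin hP x)

theorem hitWithin_le_hitProb (hP : IsStochastic P) (N : ℕ) (x : S) :
    hitWithin P K T N x ≤ hitProb P K T x :=
  le_ciSup (bddAbove_hitWithin hP x) N

theorem hitProb_nonneg (hP : IsStochastic P) (x : S) : 0 ≤ hitProb P K T x :=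
  (hitWithin_nonneg hP 0 x).trans (hitWithin_le_hitProb hP 0 x)

theorem hitProb_le_one (hP : IsStochastic P) (x : S) : hitProb P K T x ≤ 1 :=
  ciSup_le fun N => hitWithin_le_one hP N x

theorem hitProb_of_mem {x : S} (hx : x ∈ T) : hitProb P K T x = 1 := by
  simp [hitProb, hitWithin_of_mem hx]

theorem hitProb_of_notMem {x : S} (hxT : x ∉ T) (hxK : x ∉ K) : hitProb P K T x = 0 := by
  simp [hitProb, hitWithin_of_notMem hxT hxK]

/-- The hitting probability is harmonic on `K \ T`. -/
theorem hitProb_eq_sum (hP : IsStochastic P) {x : S} (hxT : x ∉ T) (hxK : x ∈ K) :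
    hitProb P K T x = ∑ y, P x y * hitProb P K T y := by
  refine tendsto_nhds_unique ((tendsto_add_atTop_iff_nat 1).2 (tendsto_hitWithin hP x)) ?_
  simp only [hitWithin_succ hxT hxK]
  exact tendsto_finsetSum _ fun y _ => (tendsto_hitWithin hP y).const_mul _

theorem hitProb_add_le_one (hP : IsStochastic P) {T' : Set S} (hT : Disjoint T T')
    (hK : Disjoint K T) (hK' : Disjoint K T') (x : S) :
    hitProb P K T x + hitProb P K T' x ≤ 1 :=
  le_of_tendsto ((tendsto_hitWithin hP x).add (tendsto_hitWithin hP x))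
    (Eventually.of_forall fun N => hitWithin_add_le_one hP hT hK hK' N x)

/-- To hit `T` within `K`, it suffices to hit `T'` within `K' ⊆ K` first. -/
theorem hitProb_mul_le (hP : IsStochastic P) {K' T' : Set S} (hK : K' ⊆ K) {θ : ℝ} (hθ : θ ≤ 1)
    (h : ∀ t ∈ T', θ ≤ hitProb P K T t) (x : S) :
    hitProb P K' T' x * θ ≤ hitProb P K T x := by
  refine le_of_tendsto ((tendsto_hitWithin hP x).mul_const θ) (Eventually.of_forall fun N => ?_)
  change hitWithin P K' T' N x * θ ≤ _
  induction N generalizing x with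
  | zero =>
    by_cases hx : x ∈ T'
    · rw [hitWithin_of_mem hx, one_mul]
      exact h x hx
    · rw [hitWithin_zero hx, zero_mul]
      exact hitProb_nonneg hP x
  | succ N ih =>
    by_cases hx : x ∈ T'
    · rw [hitWithin_of_mem hx, one_mul]
      exact h x hx
    by_cases hxK : x ∈ K'
    · by_cases hxT : x ∈ T
      · rw [hitProb_of_mem hxT]
        have h0 := hitWithin_nonneg (K := K') (T := T') hP (N + 1) x
        have h1 := hitWithin_le_one (K := K') (T := T') hP (N + 1) x
        nlinarith
      · rw [hitWithin_succ hx hxK, hitProb_eq_sum hP hxT (hK hxK), Finset.sum_mul]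
        refine Finset.sum_le_sum fun y _ => ?_
        rw [mul_assoc]
        exact mul_le_mul_of_nonneg_left (ih y) (hP.nonneg x y)
    · rw [hitWithin_of_notMem hx hxK, zero_mul]
      exact hitProb_nonneg hP x

end Hitting

/-! ### Dirichlet's principle on a finite network -/

section Dirichlet

variable {S : Type*} [Fintype S]

theorem sum_sum_mul_sub_mul_sub {c : S → S → ℝ} (hc : ∀ x y, c x y = c y x) (g v : S → ℝ) :
    ∑ x, ∑ y, c x y * ((g x - g y) * (v x - v y)) =
      2 * ∑ x, g x * ∑ y, c x y * (v x - v y) := by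
  have h1 : ∑ x, ∑ y, c x y * ((g x - g y) * (v x - v y)) =
      ∑ x, ∑ y, c x y * (g x * (v x - v y)) + ∑ x, ∑ y, c x y * (g y * (v y - v x)) := by
    simp only [← Finset.sum_add_distrib]
    exact Finset.sum_congr rfl fun x _ => Finset.sum_congr rfl fun y _ => by ring
  have h2 : ∑ x, ∑ y, c x y * (g y * (v y - v x)) = ∑ x, ∑ y, c x y * (g x * (v x - v y)) := by
    rw [Finset.sum_comm]
    exact Finset.sum_congr rfl fun x _ => Finset.sum_congr rfl fun y _ => by rw [hc y x]
  rw [h1, h2, ← two_mul]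
  simp only [Finset.mul_sum]
  exact Finset.sum_congr rfl fun x _ => Finset.sum_congr rfl fun y _ => by ring

open Classical in
/-- If `v` is harmonic on `K`, vanishes on `T` and equals `1` elsewhere, then its gradient along any
edge at `K` is controlled by the total conductance from `K` to the complement of `K ∪ T`. -/
theorem mul_sub_sq_le_of_harmonic {c : S → S → ℝ} (hc : ∀ x y, c x y = c y x)
    (hc0 : ∀ x y, 0 ≤ c x y) {K T : Set S} {v : S → ℝ}
    (hv : ∀ x ∈ K, ∑ y, c x y * (v x - v y) = 0) (hvT : ∀ x ∉ K, x ∈ T → v x = 0)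
    (hv1 : ∀ x ∉ K, x ∉ T → v x = 1) {a : S} (ha : a ∈ K) (b : S) :
    c a b * (v a - v b) ^ 2 ≤
      2 * ∑ x, ∑ y, if x ∈ K ∧ y ∉ K ∧ y ∉ T then c x y else 0 := by
  -- Only edges touching `K` are kept. The test function `f` has the same boundary values as `v` and
  -- is `0` on `K`.
  set c' : S → S → ℝ := fun x y => if x ∈ K ∨ y ∈ K then c x y else 0 with hc'
  set f : S → ℝ := fun x => if x ∈ K ∨ x ∈ T then 0 else 1 with hf
  have hsymm : ∀ x y, c' x y = c' y x := fun x y => by simp only [hc', hc x y, or_comm]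
  have hnn : ∀ x y, 0 ≤ c' x y := fun x y => by
    simp only [hc']
    split_ifs
    exacts [hc0 x y, le_rfl]
  have hg : ∀ x ∉ K, v x - f x = 0 := fun x hx => by
    by_cases hT : x ∈ T
    · simp [hf, hT, hvT x hx hT]
    · simp [hf, hT, hx, hv1 x hx hT]
  -- Summation by parts: `v - f` vanishes off `K`, while `v` is harmonic on `K`. Hence `v` has the
  -- least Dirichlet energy.
  have horth : ∑ x, ∑ y, c' x y * (((v x - f x) - (v y - f y)) * (v x - v y)) = 0 := by
    rw [sum_sum_mul_sub_mul_sub hsymm (fun x => v x - f x) v]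
    refine mul_eq_zero_of_right _ (Finset.sum_eq_zero fun x _ => ?_)
    by_cases hx : x ∈ K
    · simp only [hc', hx, true_or, if_true, hv x hx, mul_zero]
    · rw [hg x hx, zero_mul]
  have hle : ∑ x, ∑ y, c' x y * (v x - v y) ^ 2 ≤ ∑ x, ∑ y, c' x y * (f x - f y) ^ 2 := by
    have hsq : 0 ≤ ∑ x, ∑ y, c' x y * ((v x - f x) - (v y - f y)) ^ 2 :=
      Finset.sum_nonneg fun x _ => Finset.sum_nonneg fun y _ => mul_nonneg (hnn x y) (sq_nonneg _)
    have hexp : ∑ x, ∑ y, c' x y * (f x - f y) ^ 2 = ∑ x, ∑ y, c' x y * (v x - v y) ^ 2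
        - 2 * ∑ x, ∑ y, c' x y * (((v x - f x) - (v y - f y)) * (v x - v y))
        + ∑ x, ∑ y, c' x y * ((v x - f x) - (v y - f y)) ^ 2 := by
      simp only [Finset.mul_sum, ← Finset.sum_sub_distrib, ← Finset.sum_add_distrib]
      exact Finset.sum_congr rfl fun x _ => Finset.sum_congr rfl fun y _ => by ring
    rw [hexp, horth]
    linarith
  have hterm : c a b * (v a - v b) ^ 2 ≤ ∑ x, ∑ y, c' x y * (v x - v y) ^ 2 := by
    have h0 : ∀ x y, 0 ≤ c' x y * (v x - v y) ^ 2 :=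
      fun x y => mul_nonneg (hnn x y) (sq_nonneg _)
    have h1 : c a b * (v a - v b) ^ 2 = c' a b * (v a - v b) ^ 2 := by simp [hc', ha]
    rw [h1]
    exact (Finset.single_le_sum (fun y _ => h0 a y) (Finset.mem_univ b)).trans
      (Finset.single_le_sum (f := fun x => ∑ y, c' x y * (v x - v y) ^ 2)
        (fun x _ => Finset.sum_nonneg fun y _ => h0 x y) (Finset.mem_univ a))
  set D : S → S → ℝ := fun x y => if x ∈ K ∧ y ∉ K ∧ y ∉ T then c x y else 0 with hD
  -- Among the kept edges, `f` varies only across those joining `K` to the complement of `K ∪ T`,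
  -- each counted in both orientations.
  have hfD : ∑ x, ∑ y, c' x y * (f x - f y) ^ 2 ≤ ∑ x, ∑ y, (D x y + D y x) := by
    refine Finset.sum_le_sum fun x _ => Finset.sum_le_sum fun y _ => ?_
    have := hc0 x y
    have := hc x y
    by_cases hxK : x ∈ K <;> by_cases hyK : y ∈ K <;> by_cases hxT : x ∈ T <;>
      by_cases hyT : y ∈ T <;> simp [hc', hf, hD, hxK, hyK, hxT, hyT] <;> linarith
  have hDD : ∑ x, ∑ y, (D x y + D y x) = 2 * ∑ x, ∑ y, D x y := by
    simp only [Finset.sum_add_distrib]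
    rw [Finset.sum_comm (f := fun x y => D y x), two_mul]
  exact (hterm.trans hle).trans (hfD.trans hDD.le)

end Dirichlet

namespace LowTemperatureChain

variable {S : Type*} [Fintype S] {L : EnergyLandscape S} (C : LowTemperatureChain L)

/-! ### Elementary properties of the chain -/

theorem isStochastic {β : ℝ} (hβ : 0 < β) : IsStochastic (C.P β) :=
  ⟨(C.irreducible β hβ).nonneg, C.row_sum β hβ⟩

theorem preconnected (C : LowTemperatureChain L) : L.graph.Preconnected := by
  intro x y
  let : Quiver S := Matrix.toQuiver (C.P 1)
  obtain ⟨p, -⟩ := (C.irreducible 1 one_pos).connected x y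
  induction p with
  | nil => exact .refl _
  | @cons b c p e ih =>
    refine ih.trans ?_
    rcases (C.pos_iff 1 one_pos b c).1 e.down with rfl | h
    exacts [.refl _, h.reachable]

theorem P_eq_zero {β : ℝ} (hβ : 0 < β) {x y : S} (hne : x ≠ y) (h : ¬ L.graph.Adj x y) :
    C.P β x y = 0 := by
  refine le_antisymm (not_lt.1 fun hpos => ?_) ((C.isStochastic hβ).nonneg x y)
  exact ((C.pos_iff β hβ x y).1 hpos).elim hne h

theorem P_pos {β : ℝ} (hβ : 0 < β) {x y : S} (h : L.graph.Adj x y) : 0 < C.P β x y :=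
  (C.pos_iff β hβ x y).2 (.inr h)

/-- By detailed balance, with `u⁺ - (-u)⁺ = u`; each of the two transition bounds contributes one
error term. -/
theorem π_le_of_adj {β : ℝ} (hβ : 0 < β) {r s : S} (h : L.graph.Adj r s) :
    C.π β r ≤ C.π β s *
      Real.exp (-β * (L.energy r - L.energy s - 2 * (C.γ β / Fintype.card S))) := by
  set g := C.γ β / Fintype.card S
  set u := L.energy s - L.energy r
  have h1 := C.lower_bound β hβ r s h
  have h2 := C.upper_bound β hβ s r h.symm
  have hrev := C.reversible β hβ r s
  have hr := (C.π_mem β hβ).1 r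
  have hs := (C.π_mem β hβ).1 s
  have hmax : max u 0 - max (L.energy r - L.energy s) 0 = u := by
    rcases le_total (L.energy r) (L.energy s) with h | h
    · rw [max_eq_left (by simp only [u]; linarith), max_eq_right (by linarith), sub_zero]
    · rw [max_eq_right (by simp only [u]; linarith), max_eq_left (by linarith)]
      simp only [u]; ring
  have key : C.π β r * Real.exp (-β * (max u 0 + g)) ≤
      C.π β s * Real.exp (-β * (max (L.energy r - L.energy s) 0 - g)) :=
    (mul_le_mul_of_nonneg_left h1 hr).trans (hrev.le.trans (mul_le_mul_of_nonneg_left h2 hs))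
  have hexp : Real.exp (-β * (max (L.energy r - L.energy s) 0 - g)) =
      Real.exp (-β * (L.energy r - L.energy s - 2 * g)) * Real.exp (-β * (max u 0 + g)) := by
    rw [← Real.exp_add]
    congr 1
    have : max u 0 = u + max (L.energy r - L.energy s) 0 := by linarith
    rw [this]
    simp only [u]
    ring
  rw [hexp, ← mul_assoc] at key
  exact le_of_mul_le_mul_right key (Real.exp_pos _)

/-- The neighbour estimate is chained along a fixed walk. What matters is that `l`, twice the length
of the walk, does not depend on `β`. -/
theorem exists_π_le (x a : S) : ∃ l : ℝ, ∀ β > 0, C.π β x ≤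
    C.π β a * Real.exp (-β * (L.energy x - L.energy a - l * (C.γ β / Fintype.card S))) := by
  obtain ⟨w⟩ := C.preconnected x a
  induction w with
  | nil => exact ⟨0, fun β _ => by simp⟩
  | @cons x y a h w ih =>
    obtain ⟨l, hl⟩ := ih
    refine ⟨l + 2, fun β hβ => (C.π_le_of_adj hβ h).trans ?_⟩
    refine (mul_le_mul_of_nonneg_right (hl β hβ) (Real.exp_pos _).le).trans_eq ?_
    rw [mul_assoc, ← Real.exp_add]
    congr 2
    ring

theorem π_pos {β : ℝ} (hβ : 0 < β) (x : S) : 0 < C.π β x := by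
  refine lt_of_le_of_ne ((C.π_mem β hβ).1 x) fun h0 => ?_
  have : ∀ y, C.π β y = 0 := fun y => by
    obtain ⟨l, hl⟩ := C.exists_π_le y x
    have := hl β hβ
    rw [← h0, zero_mul] at this
    exact le_antisymm this ((C.π_mem β hβ).1 y)
  have h1 := (C.π_mem β hβ).2
  simp [this] at h1

/-- The conductance of an edge is governed by the energy of its higher end point. -/
theorem tendsto_conductance_div {x y a b : S} (hxy : L.graph.Adj x y) (hab : L.graph.Adj a b)
    (h : max (L.energy a) (L.energy b) < max (L.energy x) (L.energy y)) :
    Tendsto (fun β => (C.π β x * C.P β x y) / (C.π β a * C.P β a b)) atTop (𝓝 0) := by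
  obtain ⟨l, hl⟩ := C.exists_π_le x a
  set Δ := max (L.energy x) (L.energy y) - max (L.energy a) (L.energy b) with hΔ
  have hΔ0 : 0 < Δ := sub_pos.2 h
  -- The energy gap `Δ` is fixed, whereas the accumulated errors, `l` from `π` and one from each
  -- transition bound, are multiples of `γ β` and vanish.
  have hlim : Tendsto (fun β => Real.exp (-β * (Δ - (l + 2) * (C.γ β / Fintype.card S))))
      atTop (𝓝 0) := by
    refine Real.tendsto_exp_atBot.comp ?_
    simp only [neg_mul]
    refine tendsto_neg_atTop_atBot.comp (tendsto_id.atTop_mul_pos hΔ0 ?_)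
    simpa using ((C.γ_tendsto.div_const (Fintype.card S : ℝ)).const_mul (l + 2)).const_sub Δ
  refine tendsto_of_tendsto_of_tendsto_of_le_of_le' tendsto_const_nhds hlim ?_ ?_
  · filter_upwards [eventually_gt_atTop 0] with β hβ
    have := C.π_pos hβ x
    have := C.π_pos hβ a
    have := C.P_pos hβ hxy
    have := C.P_pos hβ hab
    positivity
  · filter_upwards [eventually_gt_atTop 0] with β hβ
    have ha := C.π_pos hβ a
    set g := C.γ β / Fintype.card S
    rw [div_le_iff₀ (mul_pos ha (C.P_pos hβ hab))]
    have h1 := C.lower_bound β hβ a b hab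
    have h2 := C.upper_bound β hβ x y hxy
    have e1 : max (L.energy y - L.energy x) 0 = max (L.energy x) (L.energy y) - L.energy x := by
      rw [max_comm (L.energy x), ← max_sub_sub_right, sub_self]
    have e2 : max (L.energy b - L.energy a) 0 = max (L.energy a) (L.energy b) - L.energy a := by
      rw [max_comm (L.energy a), ← max_sub_sub_right, sub_self]
    calc C.π β x * C.P β x y
        ≤ C.π β a * Real.exp (-β * (L.energy x - L.energy a - l * g)) *
          Real.exp (-β * (max (L.energy y - L.energy x) 0 - g)) :=
          mul_le_mul (hl β hβ) h2 ((C.isStochastic hβ).nonneg x y)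
            (mul_nonneg ha.le (Real.exp_pos _).le)
      _ = Real.exp (-β * (Δ - (l + 2) * g)) *
          (C.π β a * Real.exp (-β * (max (L.energy b - L.energy a) 0 + g))) := by
          rw [mul_left_comm (Real.exp _), mul_assoc, ← Real.exp_add, ← Real.exp_add, e1, e2, hΔ]
          congr 2
          ring
      _ ≤ Real.exp (-β * (Δ - (l + 2) * g)) * (C.π β a * C.P β a b) := by gcongr

/-! ### Sets which are hit with high probability -/

/-- In the limit `β → ∞`, the chain started at `x` hits `T` before it leaves `K ∪ T`. -/
def HitsWhp (K T : Set S) (x : S) : Prop :=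
  Tendsto (fun β => hitProb (C.P β) K T x) atTop (𝓝 1)

variable {C}

theorem HitsWhp.of_mem {K T : Set S} {x : S} (hx : x ∈ T) : C.HitsWhp K T x := by
  simp only [HitsWhp, hitProb_of_mem hx]
  exact tendsto_const_nhds

/-- First reach the intermediate target `T'`, then continue from there to `T`. -/
theorem HitsWhp.trans {K K' T T' : Set S} {x : S} (hK : K' ⊆ K) (h : C.HitsWhp K' T' x)
    (hT : ∀ t ∈ T', C.HitsWhp K T t) : C.HitsWhp K T x := by
  classical
  -- Summing the failure probabilities over the finite set `T'` gives one lower bound valid at all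
  -- its points.
  set θ : ℝ → ℝ := fun β => 1 - ∑ t with t ∈ T', (1 - hitProb (C.P β) K T t) with hθ
  have hlim : Tendsto θ atTop (𝓝 1) := by
    have : Tendsto (fun β => ∑ t with t ∈ T', (1 - hitProb (C.P β) K T t)) atTop
        (𝓝 (∑ t : S with t ∈ T', ((1 : ℝ) - 1))) :=
      tendsto_finsetSum _ fun t ht => (hT t (Finset.mem_filter.1 ht).2).const_sub 1
    simpa only [sub_self, Finset.sum_const_zero, sub_zero] using this.const_sub 1
  have hlow : Tendsto (fun β => hitProb (C.P β) K' T' x * θ β) atTop (𝓝 1) := by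
    simpa using Tendsto.mul h hlim
  refine tendsto_of_tendsto_of_tendsto_of_le_of_le' hlow tendsto_const_nhds ?_ ?_
  · filter_upwards [eventually_gt_atTop 0] with β hβ
    have hP := C.isStochastic hβ
    have hnn : ∀ t, 0 ≤ 1 - hitProb (C.P β) K T t := fun t => sub_nonneg.2 (hitProb_le_one hP t)
    refine hitProb_mul_le hP hK ?_ (fun t ht => ?_) x
    · exact sub_le_self _ (Finset.sum_nonneg fun t _ => hnn t)
    · have := Finset.single_le_sum (f := fun t => 1 - hitProb (C.P β) K T t)
        (s := Finset.univ.filter (· ∈ T')) (fun t _ => hnn t)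
        (Finset.mem_filter.2 ⟨Finset.mem_univ t, ht⟩)
      simp only [hθ]
      linarith
  · filter_upwards [eventually_gt_atTop 0] with β hβ
    exact hitProb_le_one (C.isStochastic hβ) x

theorem HitsWhp.mono {K K' T : Set S} {x : S} (hK : K' ⊆ K) (h : C.HitsWhp K' T x) :
    C.HitsWhp K T x :=
  h.trans hK fun _ ht => .of_mem ht

/-- If a walk from `x` to `T` inside `K ∪ T` is lower than every exit from `K` not in `T`, then the
chain exits from `K` through `T`. -/
theorem HitsWhp.of_joinedWithin {K T : Set S} {x t : S} {H : ℝ} (ht : t ∈ T)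
    (h : L.JoinedWithin ((K ∪ T) ∩ {v | L.energy v ≤ H}) x t)
    (hout : ∀ a ∈ K, ∀ y, y ∉ K → y ∉ T → L.graph.Adj a y → H < L.energy y) :
    C.HitsWhp K T x := by
  classical
  refine h.induction (p := C.HitsWhp K T) (.of_mem ht) fun a b ha hb hab _ ih => ?_
  by_cases haT : a ∈ T
  · exact .of_mem haT
  have haK : a ∈ K := ha.1.resolve_right haT
  -- Conductances of the undesired exits. Their outer end points lie above `H`, whereas the edge
  -- from `a` to `b` does not, so their ratios to its conductance vanish.
  set D : ℝ → S → S → ℝ := fun β x y =>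
    if x ∈ K \ T ∧ y ∉ K \ T ∧ y ∉ T then C.π β x * C.P β x y else 0 with hD
  have hDlim : ∀ x y, Tendsto (fun β => D β x y / (C.π β a * C.P β a b)) atTop (𝓝 0) := by
    intro x y
    by_cases hxy : x ∈ K \ T ∧ y ∉ K \ T ∧ y ∉ T
    · have hyK : y ∉ K := fun hy => hxy.2.1 ⟨hy, hxy.2.2⟩
      simp only [hD, if_pos hxy]
      by_cases hadj : L.graph.Adj x y
      · refine C.tendsto_conductance_div hadj hab ?_
        exact (max_le ha.2 hb.2).trans_lt
          ((hout x hxy.1.1 y hyK hxy.2.2 hadj).trans_le (le_max_right _ _))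
      · refine (tendsto_congr' ?_).2 tendsto_const_nhds
        filter_upwards [eventually_gt_atTop 0] with β hβ
        have hne : x ≠ y := fun h => hyK (h ▸ hxy.1.1)
        rw [C.P_eq_zero hβ hne hadj, mul_zero, zero_div]
    · simp only [hD, if_neg hxy, zero_div]
      exact tendsto_const_nhds
  have hsum : Tendsto (fun β => 2 * ∑ x, ∑ y, D β x y / (C.π β a * C.P β a b)) atTop (𝓝 0) := by
    simpa using (tendsto_finsetSum Finset.univ fun x _ =>
      tendsto_finsetSum Finset.univ fun y _ => hDlim x y).const_mul 2
  have hsq : Tendsto (fun β => (hitProb (C.P β) K T b - hitProb (C.P β) K T a) ^ 2) atTop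
      (𝓝 0) := by
    refine tendsto_of_tendsto_of_tendsto_of_le_of_le' tendsto_const_nhds hsum
      (Eventually.of_forall fun β => sq_nonneg _) ?_
    filter_upwards [eventually_gt_atTop 0] with β hβ
    have hP := C.isStochastic hβ
    have hpos : 0 < C.π β a * C.P β a b := mul_pos (C.π_pos hβ a) (C.P_pos hβ hab)
    -- The failure probability is the harmonic potential. Using `K \ T` keeps the target out of the
    -- region of harmonicity.
    have key := mul_sub_sq_le_of_harmonic (c := fun x y => C.π β x * C.P β x y)
      (C.reversible β hβ) (fun x y => mul_nonneg (C.π_pos hβ x).le (hP.nonneg x y))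
      (K := K \ T) (T := T) (v := fun x => 1 - hitProb (C.P β) K T x)
      (fun x hx => ?_) (fun x _ hx => ?_) (fun x hx hx' => ?_) (a := a) ⟨haK, haT⟩ b
    · simp only [← Finset.sum_div]
      rw [← mul_div_assoc, le_div_iff₀ hpos, mul_comm]
      refine le_trans (le_of_eq ?_) (key.trans_eq ?_)
      · ring
      · simp only [hD]
        congr!
    · have h1 : ∀ y, C.π β x * C.P β x y *
          ((1 - hitProb (C.P β) K T x) - (1 - hitProb (C.P β) K T y)) =
          C.π β x * (C.P β x y * hitProb (C.P β) K T y
            - C.P β x y * hitProb (C.P β) K T x) := fun y => by ring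
      simp only [h1]
      rw [← Finset.mul_sum, Finset.sum_sub_distrib, ← hitProb_eq_sum hP hx.2 hx.1,
        ← Finset.sum_mul, hP.row_sum, one_mul, sub_self, mul_zero]
    · simp only [hitProb_of_mem hx, sub_self]
    · rw [hitProb_of_notMem hx' fun h => hx ⟨h, hx'⟩, sub_zero]
  -- The hitting probabilities at the two ends of the edge share their limit, so the value `1`
  -- propagates back along the walk.
  have hdiff : Tendsto (fun β => hitProb (C.P β) K T b - hitProb (C.P β) K T a) atTop (𝓝 0) := by
    have := (Real.continuous_sqrt.tendsto 0).comp hsq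
    simp only [Real.sqrt_zero, Function.comp_def, Real.sqrt_sq_eq_abs] at this
    exact (tendsto_zero_iff_abs_tendsto_zero _).2 this
  have hlim := Tendsto.sub ih hdiff
  simp only [sub_sub_cancel, sub_zero] at hlim
  exact hlim

/-! ### Valleys -/

open EnergyLandscape

/-- Two stages: enter the inner valley, then descend within it to `m`. In both, the confining set is
a component at height `height x m`, so every undesired exit is strictly higher. -/
theorem hitsWhp_of_attracted {i : ℕ} (hi : 1 ≤ i) {x m : S} (h : L.Attracted i x m) :
    C.HitsWhp {s | L.Attracted i s m} {m} x := by
  have hc := C.preconnected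
  have inner : ∀ x ∈ L.innerValley i m, C.HitsWhp {s | L.Attracted i s m} {m} x := by
    intro x hx
    set K := {v | L.JoinedWithin {v | L.energy v ≤ L.height x m} x v} with hK
    have hKA : K ⊆ {s | L.Attracted i s m} := fun v hv => attracted_of_mem_innerValley h.1
      (mem_innerValley_of_height_le hc hx ((height_le_iff hc).2 hv))
    refine HitsWhp.mono hKA (.of_joinedWithin (H := L.height x m) rfl
      ((joinedWithin_height hc x m).inter_joinedWithin.mono ?_) ?_)
    · rintro v ⟨hv, hv'⟩
      exact ⟨.inl hv', hv⟩
    · intro a ha y hy _ hay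
      by_contra! hle
      exact hy (ha.trans (.of_adj ha.right_mem hle hay))
  by_cases hx : x ∈ L.innerValley i m
  · exact inner x hx
  -- Components of `A` consist of attracted states, and a step out of one leads either into the
  -- inner valley or above the height.
  set A := {v | L.energy v ≤ L.height x m} ∩ (L.innerValley i m)ᶜ with hA
  have hKA : {v | L.JoinedWithin A x v} ⊆ {s | L.Attracted i s m} :=
    fun v hv => h.of_joinedWithin hc hv
  rcases (joinedWithin_height hc x m).inter_or_exit (L.innerValley i m)ᶜ hx with
    hJ | ⟨q, p, hq, hqp, hpA, hp, hpm⟩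
  · exact absurd (mem_innerValley_self hc hi h.1) hJ.right_mem.2
  have hp' : p ∈ L.innerValley i m := not_not.1 hp
  have hJ : L.JoinedWithin (({v | L.JoinedWithin A x v} ∪ L.innerValley i m) ∩
      {v | L.energy v ≤ L.height x m}) x q := by
    refine hq.inter_joinedWithin.mono ?_
    rintro v ⟨hv, hv'⟩
    exact ⟨.inl hv', hv.1⟩
  refine HitsWhp.trans hKA (.of_joinedWithin (H := L.height x m) hp'
    (hJ.trans (.of_adj hJ.right_mem ⟨.inr hp', hpA⟩ hqp)) ?_) inner
  intro a ha y hy hyV hay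
  by_contra! hle
  exact hy (ha.trans (.of_adj ha.right_mem ⟨hle, hyV⟩ hay))

/-- From everywhere in a valley, the chain reaches the minimum before it leaves the valley. -/
theorem hitsWhp_minimum {i j : ℕ} (hj : j ∈ Set.Icc 1 L.numMinima) {x : S}
    (hx : x ∈ L.valleyOrder i j) : C.HitsWhp (L.valleyOrder i j) {L.minimum j} x := by
  have hc := C.preconnected
  induction i generalizing j x with
  | zero => exact hx.elim
  | succ i ih =>
    rcases mem_valleyOrder_succ.1 hx with hx | ⟨hij, hor⟩
    · exact (ih hj hx).mono (valleyOrder_mono i.le_succ j)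
    have hA : ∀ {s}, L.Attracted (i + 1) s (L.minimum j) →
        C.HitsWhp (L.valleyOrder (i + 1) j) {L.minimum j} s :=
      fun h => (hitsWhp_of_attracted (by lia) h).mono fun s hs =>
        Attracted.mem_valleyOrder hc hij hj hs
    rcases hor with ⟨-, hx⟩ | ⟨k, hk, hki, hlk, hatt, hx⟩
    · exact hA hx
    · refine (ih ⟨hk, by have := hj.2; lia⟩ hx).trans (fun s hs => ?_) ?_
      · exact mem_valleyOrder_succ.2 (.inr ⟨hij, .inr ⟨k, hk, hki, hlk, hatt, hs⟩⟩)
      · rintro _ rfl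
        exact hA hatt

/-- From everywhere in the valley of a metastate, the chain leaves the valley through its lowest
exit. -/
theorem hitsWhp_exitState {i j : ℕ} (hi : 1 ≤ i) (hin : i < L.numMinima)
    (hj : j ∈ Set.Icc 1 L.numMinima) (hl : (i : ℕ∞) < L.mergeLevel j) {x : S}
    (hx : x ∈ L.valleyOrder i j) :
    C.HitsWhp (L.valleyOrder i j) {L.exitState i (L.minimum j)} x := by
  have hc := C.preconnected
  refine (hitsWhp_minimum hj hx).trans subset_rfl ?_
  rintro _ rfl
  obtain ⟨⟨hsV, q, hq, hqs⟩, hmin⟩ := exitState_spec hc hi hin hj hl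
  set s := L.exitState i (L.minimum j)
  -- Read backwards, the walk from `q` to the minimum gives an approach to the exit staying below
  -- it.
  have hJ := (joinedWithin_valleyOrder hc hj hq hsV hqs).symm.mono
    (B := (L.valleyOrder i j ∪ {s}) ∩ {v | L.energy v ≤ L.energy s}) (by
      rintro v ⟨hv, hv'⟩
      exact ⟨.inl hv, (show L.energy v < L.energy s from hv').le⟩)
  refine .of_joinedWithin (H := L.energy s) rfl
    (hJ.trans (.of_adj hJ.right_mem ⟨.inr rfl, le_refl (L.energy s)⟩ hqs)) ?_
  intro a ha y hy hys hay
  -- Injectivity of the energy makes every other exit strictly higher.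
  exact lt_of_le_of_ne (hmin y ⟨hy, a, ha, hay⟩) fun h => hys (L.energy_injective h).symm

end LowTemperatureChain

/-! ### Jump times -/

section JumpTime

variable {α : Type*} {y y' : ℕ → α}

theorem forall_eq_pred_iff {j k : ℕ} :
    (∀ l, j < l → l < k → y l = y (l - 1)) ↔ ∀ l, j ≤ l → l < k → y l = y j := by
  constructor
  · intro h l hjl
    induction l, hjl using Nat.le_induction with
    | base => exact fun _ => rfl
    | succ l hl ih => exact fun hlk => (h (l + 1) (by lia) hlk).trans (ih (by lia))
  · intro h l hjl hlk
    rw [h l hjl.le hlk, h (l - 1) (by lia) (by lia)]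

/-- Replaces the infimum over predecessor comparisons by constancy since the previous, necessarily
finite, jump. -/
theorem jumpTime_succ_eq_iff {n k : ℕ} : jumpTime y (n + 1) = k ↔
    ∃ j : ℕ, jumpTime y n = j ∧ j < k ∧ y k ≠ y j ∧ ∀ l, j ≤ l → l < k → y l = y j := by
  rw [jumpTime]
  set A : Set ℕ∞ := {k : ℕ∞ | ∃ k' : ℕ, k = k' ∧ jumpTime y n < k' ∧ y k' ≠ y (k' - 1)} with hA
  constructor
  · intro h
    have hne : A.Nonempty := by
      by_contra hempty
      rw [Set.not_nonempty_iff_eq_empty] at hempty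
      rw [hempty, sInf_empty] at h
      exact ENat.natCast_ne_top k h.symm
    obtain ⟨k', hk', hlt, hy⟩ := csInf_mem hne
    obtain rfl : k = k' := by
      have : (k : ℕ∞) = k' := h.symm.trans hk'
      exact_mod_cast this
    obtain ⟨j, hj⟩ := ENat.ne_top_iff_exists.1 hlt.ne_top
    rw [← hj] at hlt
    have hjk : j < k := by exact_mod_cast hlt
    have hconst : ∀ l, j ≤ l → l < k → y l = y j := by
      refine forall_eq_pred_iff.1 fun l hjl hlk => ?_
      by_contra hne
      have : sInf A ≤ l := sInf_le ⟨l, rfl, by rw [← hj]; exact_mod_cast hjl, hne⟩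
      rw [h] at this
      exact absurd (by exact_mod_cast this : k ≤ l) (by lia)
    exact ⟨j, hj.symm, hjk, hconst (k - 1) (by lia) (by lia) ▸ hy, hconst⟩
  · rintro ⟨j, hj, hjk, hy, hconst⟩
    refine le_antisymm (sInf_le ⟨k, rfl, by rw [hj]; exact_mod_cast hjk, ?_⟩) (le_sInf ?_)
    · rwa [hconst (k - 1) (by lia) (by lia)]
    · rintro _ ⟨l, rfl, hl, hyl⟩
      rw [hj] at hl
      by_contra! hlk
      exact hyl (forall_eq_pred_iff.2 hconst l (by exact_mod_cast hl) (by exact_mod_cast hlk))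

/-- The stopping time property of the jump times, stated pathwise. -/
theorem jumpTime_congr {n k : ℕ} (h : jumpTime y n = k) (hyy' : ∀ l ≤ k, y l = y' l) :
    jumpTime y' n = k := by
  induction n generalizing k with
  | zero => exact h
  | succ n ih =>
    obtain ⟨j, hj, hjk, hne, hconst⟩ := jumpTime_succ_eq_iff.1 h
    refine jumpTime_succ_eq_iff.2
      ⟨j, ih hj fun l hl => hyy' l (hl.trans hjk.le), hjk, ?_, fun l hjl hlk => ?_⟩
    · rwa [← hyy' k le_rfl, ← hyy' j hjk.le]
    · rw [← hyy' l hlk.le, ← hyy' j hjk.le, hconst l hjl hlk]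

theorem exists_jumpTime_eq_of_le {n k t : ℕ} (h : jumpTime y n = t) (hkn : k ≤ n) :
    ∃ t' ≤ t, jumpTime y k = (t' : ℕ) := by
  induction n, hkn using Nat.le_induction generalizing t with
  | base => exact ⟨t, le_rfl, h⟩
  | succ n _ ih =>
    obtain ⟨j, hj, hjk, -⟩ := jumpTime_succ_eq_iff.1 h
    obtain ⟨t', ht', h'⟩ := ih hj
    exact ⟨t', ht'.trans hjk.le, h'⟩

theorem AcceleratedEq.congr {n k t : ℕ} {a : α} (hn : jumpTime y n = t) (hkn : k ≤ n)
    (hyy' : ∀ l ≤ t, y l = y' l) (h : AcceleratedEq y k a) : AcceleratedEq y' k a := by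
  obtain ⟨u, hu, hya⟩ := h
  obtain ⟨t', ht', hk⟩ := exists_jumpTime_eq_of_le hn hkn
  obtain rfl : u = t' := by
    have : (u : ℕ∞) = t' := hu.symm.trans hk
    exact_mod_cast this
  exact ⟨u, jumpTime_congr hu fun l hl => hyy' l (hl.trans ht'), hyy' u ht' ▸ hya⟩

/-- The next value of the accelerated sequence. -/
theorem acceleratedEq_succ_iff {n t : ℕ} {a : α} (hn : jumpTime y n = t) :
    AcceleratedEq y (n + 1) a ↔
      a ≠ y t ∧ ∃ l, y (t + l) = a ∧ ∀ k < l, y (t + k) = y t := by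
  constructor
  · rintro ⟨k, hk, rfl⟩
    obtain ⟨j, hj, hjk, hne, hconst⟩ := jumpTime_succ_eq_iff.1 hk
    obtain rfl : t = j := by
      have : (t : ℕ∞) = j := hn.symm.trans hj
      exact_mod_cast this
    exact ⟨hne, k - t, by rw [Nat.add_sub_cancel' hjk.le],
      fun l hl => hconst _ (by lia) (by lia)⟩
  · rintro ⟨hne, l, rfl, hconst⟩
    refine ⟨t + l, jumpTime_succ_eq_iff.2 ⟨t, hn, ?_, hne, fun k htk hkl => ?_⟩, rfl⟩
    · rcases l.eq_zero_or_pos with rfl | hl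
      · exact absurd rfl hne
      · lia
    · simpa [Nat.add_sub_cancel' htk] using hconst (k - t) (by lia)

end JumpTime

/-! ### Trajectories of a Markov chain -/

/-- The sequence `x` hits `T` within `N` steps, and stays in `K` before. -/
def HitsWithin {S : Type*} (K T : Set S) (N : ℕ) (x : ℕ → S) : Prop :=
  ∃ l ≤ N, x l ∈ T ∧ ∀ k < l, x k ∈ K

theorem hitsWithin_succ_iff {S : Type*} {K T : Set S} {N : ℕ} {x : ℕ → S} (hT : x 0 ∉ T) :
    HitsWithin K T (N + 1) x ↔ x 0 ∈ K ∧ HitsWithin K T N fun l => x (l + 1) := by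
  constructor
  · rintro ⟨l, hl, hlT, hlK⟩
    obtain ⟨l, rfl⟩ : ∃ l', l = l' + 1 :=
      Nat.exists_eq_succ_of_ne_zero fun h => hT (h ▸ hlT)
    exact ⟨hlK 0 (by lia), l, by lia, hlT, fun k hk => hlK (k + 1) (by lia)⟩
  · rintro ⟨h0, l, hl, hlT, hlK⟩
    refine ⟨l + 1, by lia, hlT, fun k hk => ?_⟩
    cases k with
    | zero => exact h0
    | succ k => exact hlK k (by lia)

namespace IsMarkovChain

variable {S : Type*} [Fintype S] {P : Matrix S S ℝ} {Ω : Type*} [MeasurableSpace Ω]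
  {μ : Measure Ω} {X : ℕ → Ω → S}

/-- Decomposition of an arbitrary event along a function with finitely many values. -/
theorem _root_.MeasureTheory.Measure.eq_sum_inter_fiber {ι : Type*} [Fintype ι] (μ : Measure Ω)
    (A : Set Ω) {f : Ω → ι} (hf : ∀ b, MeasurableSet (f ⁻¹' {b})) :
    μ A = ∑ b, μ (f ⁻¹' {b} ∩ A) := by
  have h := sum_measure_preimage_singleton (μ := μ.restrict A) Finset.univ (fun b _ => hf b)
  simp only [Measure.restrict_apply (hf _), Finset.coe_univ, Set.preimage_univ,
    Measure.restrict_apply_univ] at h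
  exact h.symm

/-- First-step analysis: splitting on the next state turns a cylinder of length `t` into one of
length `t + 1` and matches the recursion for `hitWithin`. -/
theorem measure_cylinder_inter_hitsWithin (hX : IsMarkovChain P μ X) (hP : IsStochastic P)
    {K T : Set S} (N t : ℕ) (x : ℕ → S) :
    μ ({ω | ∀ k ≤ t, X k ω = x k} ∩ {ω | HitsWithin K T N fun l => X (t + l) ω}) =
      μ {ω | ∀ k ≤ t, X k ω = x k} * ENNReal.ofReal (hitWithin P K T N (x t)) := by
  classical
  induction N generalizing t x with
  | zero =>
    by_cases hxT : x t ∈ T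
    · rw [hitWithin_of_mem hxT, ENNReal.ofReal_one, mul_one]
      congr 1
      refine Set.inter_eq_left.2 fun ω hω => ⟨0, le_rfl, ?_, fun k hk => absurd hk (by lia)⟩
      change X t ω ∈ T
      rw [hω t le_rfl]
      exact hxT
    · rw [hitWithin_zero hxT, ENNReal.ofReal_zero, mul_zero]
      convert measure_empty (μ := μ)
      refine Set.eq_empty_of_forall_notMem ?_
      rintro ω ⟨hω, l, hl, hlT, -⟩
      obtain rfl : l = 0 := by lia
      change X t ω ∈ T at hlT
      rw [hω t le_rfl] at hlT
      exact hxT hlT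
  | succ N ih =>
    by_cases hxT : x t ∈ T
    · rw [hitWithin_of_mem hxT, ENNReal.ofReal_one, mul_one]
      congr 1
      refine Set.inter_eq_left.2 fun ω hω => ⟨0, by lia, ?_, fun k hk => absurd hk (by lia)⟩
      change X t ω ∈ T
      rw [hω t le_rfl]
      exact hxT
    have hiff : ∀ ω, (∀ k ≤ t, X k ω = x k) →
        ((HitsWithin K T (N + 1) fun l => X (t + l) ω) ↔
          x t ∈ K ∧ HitsWithin K T N fun l => X (t + 1 + l) ω) := by
      intro ω hω
      rw [hitsWithin_succ_iff (by rwa [add_zero, hω t le_rfl]), add_zero, hω t le_rfl]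
      simp only [add_assoc, add_comm 1]
    by_cases hxK : x t ∈ K
    · rw [hitWithin_succ hxT hxK, Measure.eq_sum_inter_fiber μ _ (hX.measurable (t + 1)),
        ENNReal.ofReal_sum_of_nonneg fun y _ =>
          mul_nonneg (hP.nonneg _ y) (hitWithin_nonneg hP N y), Finset.mul_sum]
      refine Finset.sum_congr rfl fun y _ => ?_
      set x' := Function.update x (t + 1) y with hx'
      have hx't : ∀ k ≤ t, x' k = x k := fun k hk =>
        Function.update_of_ne (by lia) _ _
      have hx'y : x' (t + 1) = y := Function.update_self _ _ _
      have hcyl : {ω | ∀ k ≤ t, X k ω = x' k} = {ω | ∀ k ≤ t, X k ω = x k} := by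
        ext ω
        exact forall₂_congr fun k hk => by rw [hx't k hk]
      have hset : X (t + 1) ⁻¹' {y} ∩ ({ω | ∀ k ≤ t, X k ω = x k} ∩
            {ω | HitsWithin K T (N + 1) fun l => X (t + l) ω}) =
          {ω | ∀ k ≤ t + 1, X k ω = x' k} ∩ {ω | HitsWithin K T N fun l => X (t + 1 + l) ω} := by
        ext ω
        constructor
        · rintro ⟨hy, hω, hh⟩
          refine ⟨fun k hk => ?_, ((hiff ω hω).1 hh).2⟩
          rcases Nat.lt_or_ge t k with h | h
          · obtain rfl : k = t + 1 := by lia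
            rw [hx'y]
            exact hy
          · rw [hx't k h, hω k h]
        · rintro ⟨hω, hh⟩
          have hω' : ∀ k ≤ t, X k ω = x k := fun k hk => by rw [hω k (by lia), hx't k hk]
          exact ⟨(hω (t + 1) le_rfl).trans hx'y, hω', (hiff ω hω').2 ⟨hxK, hh⟩⟩
      rw [hset, ih (t + 1) x', hX.markov t x', hcyl, hx'y, hx't t le_rfl, mul_assoc,
        ← ENNReal.ofReal_mul (hP.nonneg _ y)]
    · rw [hitWithin_of_notMem hxT hxK, ENNReal.ofReal_zero, mul_zero]
      convert measure_empty (μ := μ)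
      refine Set.eq_empty_of_forall_notMem ?_
      rintro ω ⟨hω, hh⟩
      exact hxK ((hiff ω hω).1 hh).1

/-- The Markov property: given the first `t` steps, the chain hits `T` before it leaves `K ∪ T` with
probability `hitProb P K T (X t)`. -/
theorem measure_cylinder_inter_hits (hX : IsMarkovChain P μ X) (hP : IsStochastic P)
    {K T : Set S} (t : ℕ) (x : ℕ → S) :
    μ ({ω | ∀ k ≤ t, X k ω = x k} ∩ {ω | ∃ l, X (t + l) ω ∈ T ∧ ∀ k < l, X (t + k) ω ∈ K}) =
      μ {ω | ∀ k ≤ t, X k ω = x k} * ENNReal.ofReal (hitProb P K T (x t)) := by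
  have := hX.isProbabilityMeasure
  set A := fun N : ℕ =>
    {ω | ∀ k ≤ t, X k ω = x k} ∩ {ω | HitsWithin K T N fun l => X (t + l) ω} with hA
  have hmono : Monotone A := fun N M h ω ⟨hω, l, hl, hh⟩ => ⟨hω, l, hl.trans h, hh⟩
  have hUnion : {ω | ∀ k ≤ t, X k ω = x k} ∩
      {ω | ∃ l, X (t + l) ω ∈ T ∧ ∀ k < l, X (t + k) ω ∈ K} = ⋃ N, A N := by
    ext ω
    rw [Set.mem_iUnion]
    constructor
    · rintro ⟨hω, l, hl⟩
      exact ⟨l, hω, l, le_rfl, hl⟩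
    · rintro ⟨N, hω, l, -, hl⟩
      exact ⟨hω, l, hl⟩
  rw [hUnion]
  refine tendsto_nhds_unique (tendsto_measure_iUnion_atTop hmono) ?_
  simp only [Function.comp_def, hA, hX.measure_cylinder_inter_hitsWithin hP]
  exact ENNReal.Tendsto.const_mul (ENNReal.tendsto_ofReal (tendsto_hitWithin hP _))
    (.inr (measure_ne_top _ _))

/-- The event `A` is determined by the first `t` steps. -/
def _root_.IsDeterminedBy (X : ℕ → Ω → S) (t : ℕ) (A : Set Ω) : Prop :=
  ∀ ω ∈ A, ∀ ω', (∀ k ≤ t, X k ω' = X k ω) → ω' ∈ A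

omit [Fintype S] in
theorem measurableSet_fiber (hX : IsMarkovChain P μ X) (t : ℕ) (b : Fin (t + 1) → S) :
    MeasurableSet ((fun ω (k : Fin (t + 1)) => X k ω) ⁻¹' {b}) := by
  have : (fun ω (k : Fin (t + 1)) => X k ω) ⁻¹' {b} = ⋂ k : Fin (t + 1), {ω | X k ω = b k} := by
    ext ω
    simp [funext_iff]
  rw [this]
  exact .iInter fun k => hX.measurable k (b k)

theorem measurableSet_of_isDeterminedBy (hX : IsMarkovChain P μ X) {t : ℕ} {A : Set Ω}
    (hA : IsDeterminedBy X t A) : MeasurableSet A := by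
  set f := fun ω (k : Fin (t + 1)) => X k ω with hf
  have : A = ⋃ b ∈ f '' A, f ⁻¹' {b} := by
    ext ω
    simp only [Set.mem_iUnion, exists_prop]
    constructor
    · exact fun h => ⟨f ω, ⟨ω, h, rfl⟩, rfl⟩
    · rintro ⟨_, ⟨ω', hω', rfl⟩, hω⟩
      exact hA ω' hω' ω fun k hk => congrFun (hω : f ω = f ω') ⟨k, by lia⟩
  rw [this]
  exact .biUnion (Set.to_countable _) fun b _ => hX.measurableSet_fiber t b

/-- An event determined by `t` steps is a finite disjoint union of cylinders, on each of which the
Markov property gives the exact probability. -/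
theorem measure_inter_hits_mem_Icc (hX : IsMarkovChain P μ X) (hP : IsStochastic P)
    {K T : Set S} {a b : ℝ} (h : ∀ x ∈ K, hitProb P K T x ∈ Set.Icc a b) {t : ℕ} {A : Set Ω}
    (hA : IsDeterminedBy X t A) (hAK : ∀ ω ∈ A, X t ω ∈ K) :
    μ (A ∩ {ω | ∃ l, X (t + l) ω ∈ T ∧ ∀ k < l, X (t + k) ω ∈ K}) ∈
      Set.Icc (μ A * ENNReal.ofReal a) (μ A * ENNReal.ofReal b) := by
  have hm := hX.measurableSet_fiber t
  rw [Measure.eq_sum_inter_fiber μ A hm, Measure.eq_sum_inter_fiber μ (A ∩ _) hm,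
    Finset.sum_mul, Finset.sum_mul]
  have key : ∀ c : Fin (t + 1) → S,
      μ ((fun ω (k : Fin (t + 1)) => X k ω) ⁻¹' {c} ∩
        (A ∩ {ω | ∃ l, X (t + l) ω ∈ T ∧ ∀ k < l, X (t + k) ω ∈ K})) ∈
      Set.Icc (μ ((fun ω (k : Fin (t + 1)) => X k ω) ⁻¹' {c} ∩ A) * ENNReal.ofReal a)
        (μ ((fun ω (k : Fin (t + 1)) => X k ω) ⁻¹' {c} ∩ A) * ENNReal.ofReal b) := by
    intro c
    rcases ((fun ω (k : Fin (t + 1)) => X k ω) ⁻¹' {c} ∩ A).eq_empty_or_nonempty with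
      hempty | ⟨ω₀, hω₀, hA₀⟩
    · rw [← Set.inter_assoc, hempty]
      simp
    · have hcyl : (fun ω (k : Fin (t + 1)) => X k ω) ⁻¹' {c} =
          {ω | ∀ k ≤ t, X k ω = X k ω₀} := by
        ext ω
        obtain rfl : (fun k : Fin (t + 1) => X k ω₀) = c := hω₀
        constructor
        · exact fun hω k hk => congrFun hω ⟨k, by lia⟩
        · exact fun hω => funext fun k => hω k (by lia)
      have hsub : {ω | ∀ k ≤ t, X k ω = X k ω₀} ⊆ A := fun ω hω => hA ω₀ hA₀ ω hω
      rw [hcyl, ← Set.inter_assoc, Set.inter_eq_left.2 hsub,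
        hX.measure_cylinder_inter_hits hP t fun k => X k ω₀]
      have hab := h _ (hAK ω₀ hA₀)
      exact ⟨mul_le_mul_right (ENNReal.ofReal_le_ofReal hab.1) _,
        mul_le_mul_right (ENNReal.ofReal_le_ofReal hab.2) _⟩
  exact ⟨Finset.sum_le_sum fun c _ => (key c).1, Finset.sum_le_sum fun c _ => (key c).2⟩

end IsMarkovChain

/-! ### The aggregated chain -/

theorem IsMarkovChain.measurableSet_aacEvent {S : Type*} [Fintype S] {P : Matrix S S ℝ}
    {Ω : Type*} [MeasurableSpace Ω] {μ : Measure Ω} {X : ℕ → Ω → S} (hX : IsMarkovChain P μ X)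
    (L : EnergyLandscape S) (i n : ℕ) (r : S) : MeasurableSet (aacEvent L i X n r) := by
  have : aacEvent L i X n r = ⋃ t : ℕ, {ω | jumpTime (fun k => L.metastateOf i (X k ω)) n = t ∧
      L.metastateOf i (X t ω) = r} := by
    ext ω
    simp only [Set.mem_iUnion]
    rfl
  rw [this]
  refine .iUnion fun t => hX.measurableSet_of_isDeterminedBy (t := t) ?_
  rintro ω ⟨ht, hr⟩ ω' hω'
  have hyy' : ∀ l ≤ t, L.metastateOf i (X l ω) = L.metastateOf i (X l ω') :=
    fun l hl => by rw [hω' l hl]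
  exact ⟨jumpTime_congr ht hyy', (hyy' t le_rfl).symm.trans hr⟩

open EnergyLandscape in
/-- If the chain leaves the valley of `r` into the valley of `s` with probability between `a` and
`b`, from wherever it starts in the valley of `r`, then so does the accelerated aggregated chain,
whatever its past. -/
theorem IsMarkovChain.cond_aacEvent_mem_Icc {S : Type*} [Fintype S] {P : Matrix S S ℝ} {Ω : Type*}
    [MeasurableSpace Ω] {μ : Measure Ω} {X : ℕ → Ω → S} (hX : IsMarkovChain P μ X)
    (hP : IsStochastic P) {L : EnergyLandscape S} (hc : L.graph.Preconnected) {i : ℕ} (hi : 1 ≤ i)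
    {n : ℕ} {m : ℕ → S} {r s : S} (hr : r ∈ L.metastates i) (hs : s ∈ L.metastates i)
    (hsr : s ≠ r) {a b : ℝ} (hb : 0 ≤ b)
    (h : ∀ x ∈ L.valley i r, hitProb P (L.valley i r) (L.valley i s) x ∈ Set.Icc a b)
    (h0 : μ (aacEvent L i X n r ∩ ⋂ k < n, aacEvent L i X k (m k)) ≠ 0) :
    (μ[|aacEvent L i X n r ∩ ⋂ k < n, aacEvent L i X k (m k)]).real
      (aacEvent L i X (n + 1) s) ∈ Set.Icc a b := by
  have := hX.isProbabilityMeasure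
  set y : Ω → ℕ → S := fun ω k => L.metastateOf i (X k ω) with hy
  set G := aacEvent L i X n r ∩ ⋂ k < n, aacEvent L i X k (m k) with hG
  set F := aacEvent L i X (n + 1) s with hF
  set A : ℕ → Set Ω := fun t => {ω | jumpTime (y ω) n = t ∧ y ω t = r ∧
    ∀ k < n, AcceleratedEq (y ω) k (m k)} with hA
  have hGA : G = ⋃ t, A t := by
    ext ω
    simp only [hG, Set.mem_inter_iff, Set.mem_iInter, Set.mem_iUnion]
    constructor
    · rintro ⟨⟨t, ht, hyt⟩, hk⟩
      exact ⟨t, ht, hyt, hk⟩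
    · rintro ⟨t, ht, hyt, hk⟩
      exact ⟨⟨t, ht, hyt⟩, hk⟩
  have hdisj : Pairwise (Function.onFun Disjoint A) := by
    intro t t' htt'
    refine Set.disjoint_left.2 fun ω hω hω' => htt' ?_
    have : (t : ℕ∞) = t' := hω.1.symm.trans hω'.1
    exact_mod_cast this
  have hdet : ∀ t, IsDeterminedBy X t (A t) := by
    rintro t ω ⟨ht, hyt, hk⟩ ω' hω'
    have hyy' : ∀ l ≤ t, y ω l = y ω' l := fun l hl => by simp only [hy, hω' l hl]
    exact ⟨jumpTime_congr ht hyy', hyy' t le_rfl ▸ hyt,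
      fun k hkn => (hk k hkn).congr ht hkn.le hyy'⟩
  have hmeas : ∀ t, MeasurableSet (A t) := fun t => hX.measurableSet_of_isDeterminedBy (hdet t)
  -- Given that the `n`-th jump occurs at `t` into `r`, jumping next to `s` means staying in the
  -- valley of `r` until that of `s` is hit.
  have hAF : ∀ t, A t ∩ F = A t ∩
      {ω | ∃ l, X (t + l) ω ∈ L.valley i s ∧ ∀ k < l, X (t + k) ω ∈ L.valley i r} := by
    intro t
    ext ω
    refine and_congr_right fun ⟨ht, hyt, _⟩ => ?_
    refine (acceleratedEq_succ_iff ht).trans ?_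
    rw [hyt]
    simp only [hy, metastateOf_eq_iff hc hi hs, metastateOf_eq_iff hc hi hr, ne_eq, hsr,
      not_false_eq_true, true_and, Set.mem_ofPred_eq]
  have hbound : ∀ t, μ (A t ∩ F) ∈
      Set.Icc (μ (A t) * ENNReal.ofReal a) (μ (A t) * ENNReal.ofReal b) := by
    intro t
    rw [hAF t]
    exact hX.measure_inter_hits_mem_Icc hP h (hdet t)
      fun ω hω => (metastateOf_eq_iff hc hi hr).1 hω.2.1
  have hμG : μ G = ∑' t, μ (A t) := by rw [hGA, measure_iUnion hdisj hmeas]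
  have hmG : MeasurableSet G := hGA ▸ MeasurableSet.iUnion hmeas
  have hμGF : μ (G ∩ F) = ∑' t, μ (A t ∩ F) := by
    rw [← Measure.restrict_apply hmG, hGA, measure_iUnion hdisj hmeas]
    exact tsum_congr fun t => Measure.restrict_apply (hmeas t)
  have hlow : μ G * ENNReal.ofReal a ≤ μ (G ∩ F) := by
    rw [hμG, hμGF, ← ENNReal.tsum_mul_right]
    exact ENNReal.tsum_le_tsum fun t => (hbound t).1
  have hup : μ (G ∩ F) ≤ μ G * ENNReal.ofReal b := by
    rw [hμG, hμGF, ← ENNReal.tsum_mul_right]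
    exact ENNReal.tsum_le_tsum fun t => (hbound t).2
  have hcond : μ[|G] F = μ (G ∩ F) / μ G := by
    rw [cond_apply hmG, mul_comm, ENNReal.div_eq_inv_mul, mul_comm]
  have hGtop : μ G ≠ ⊤ := measure_ne_top μ G
  rw [measureReal_def, hcond]
  have hfin : μ (G ∩ F) / μ G ≠ ⊤ := (ENNReal.div_lt_top (measure_ne_top _ _) h0).ne
  constructor
  · refine (ENNReal.ofReal_le_iff_le_toReal hfin).1 ?_
    rwa [ENNReal.le_div_iff_mul_le (.inl h0) (.inl hGtop), mul_comm]
  · refine ENNReal.toReal_le_of_le_ofReal hb ?_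
    rwa [ENNReal.div_le_iff h0 hGtop, mul_comm]

/-! ### Limits of the exit probabilities -/

namespace LowTemperatureChain

open EnergyLandscape

variable {S : Type*} [Fintype S] {L : EnergyLandscape S} (C : LowTemperatureChain L)

theorem pstar_nonneg (r s : S) : 0 ≤ C.pstar r s :=
  ge_of_tendsto (C.tendsto_pstar r s) (by
    filter_upwards [eventually_gt_atTop 0] with β hβ
    exact (C.isStochastic hβ).nonneg r s)

theorem sum_pstar (r : S) : ∑ s, C.pstar r s = 1 := by
  refine tendsto_nhds_unique (tendsto_finsetSum _ fun s _ => C.tendsto_pstar r s) ?_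
  refine (tendsto_congr' ?_).2 tendsto_const_nhds
  filter_upwards [eventually_gt_atTop 0] with β hβ
  exact C.row_sum β hβ r

/-- A non-assigned state is not a local minimum, so positive limiting mass goes to a neighbour of no
greater energy. -/
theorem pstar_self_lt_one {i : ℕ} (hi : 1 ≤ i) {r : S} (hr : r ∈ L.nonassigned i) :
    C.pstar r r < 1 := by
  classical
  obtain ⟨s, hrs, hle⟩ : ∃ s, L.graph.Adj r s ∧ L.energy s ≤ L.energy r := by
    by_contra! hmin
    obtain ⟨j, hj, rfl⟩ := L.minimum_bijOn.surjOn hmin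
    exact minimum_notMem_nonassigned C.preconnected hi hj hr
  have hpos := C.pstar_pos r s (.inr hrs) hle
  have h2 : ∑ t ∈ {r, s}, C.pstar r t ≤ ∑ t, C.pstar r t :=
    Finset.sum_le_sum_of_subset_of_nonneg (Finset.subset_univ _)
      fun t _ _ => C.pstar_nonneg r t
  rw [Finset.sum_pair hrs.ne, C.sum_pstar] at h2
  linarith

-- Since `p*` vanishes between distinct non-neighbours, both cases of the definition become one sum
-- over a fibre of `metastateOf`, convenient for row sums and for limits.
open Classical in
theorem limitTransition_of_mem_nonassigned {i : ℕ} (hi : 1 ≤ i) {r : S}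
    (hr : r ∈ L.nonassigned i) (s : S) : C.limitTransition i r s =
      (1 - C.pstar r r)⁻¹ *
        ∑ y ∈ Finset.univ.erase r with L.metastateOf i y = s, C.pstar r y := by
  have hc := C.preconnected
  rw [limitTransition, if_pos hr]
  congr 1
  have hadj : ∀ y, y ≠ r → ¬ L.graph.Adj r y → C.pstar r y = 0 := fun y hne hny =>
    C.pstar_eq_zero r y fun h => h.1.elim (fun h => hne h.symm) hny
  by_cases hsM : s ∈ L.metastates i
  · simp only [metastateOf_eq_iff hc hi hsM]
    by_cases hsN : s ∈ L.nonassigned i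
    · rw [if_pos hsN, valley_nonassigned hc hi hsN]
      by_cases hsr : s = r
      · subst hsr
        rw [if_neg (L.graph.loopless.irrefl s), Finset.sum_eq_zero]
        intro y hy
        simp at hy
      · have hsum : ∀ F : Finset S, (∀ y, y ∈ F ↔ y ≠ r ∧ y = s) →
            ∑ y ∈ F, C.pstar r y = C.pstar r s := by
          intro F hF
          obtain rfl : F = {s} := by
            ext y
            rw [hF, Finset.mem_singleton]
            exact ⟨fun h => h.2, fun h => ⟨h ▸ hsr, h⟩⟩
          exact Finset.sum_singleton _ _
        rw [hsum _ fun y => by simp]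
        split_ifs with h
        exacts [rfl, (hadj s hsr h).symm]
    · rw [if_neg hsN, if_pos hsM]
      refine Finset.sum_subset (fun y hy => ?_) fun y hy hy' => ?_
      · simp only [Finset.mem_filter, Finset.mem_univ, true_and] at hy
        simp [hy.1.ne', hy.2]
      · simp only [Finset.mem_filter, Finset.mem_erase, Finset.mem_univ, and_true, true_and]
          at hy hy'
        exact hadj y hy.1 fun h => hy' ⟨h, hy.2⟩
  · rw [if_neg fun h => hsM (.inr h), if_neg hsM, Finset.sum_eq_zero]
    intro y hy
    exact absurd ((Finset.mem_filter.1 hy).2 ▸ metastateOf_mem hc hi y) hsM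

theorem limitTransition_self {i : ℕ} (hi : 1 ≤ i) (hin : i < L.numMinima) {r : S}
    (hr : r ∈ L.metastates i) : C.limitTransition i r r = 0 := by
  by_cases hrN : r ∈ L.nonassigned i
  · simp [limitTransition, hrN]
  · obtain ⟨j, hj, hl, rfl⟩ := exists_eq_minimum hr hrN
    rw [limitTransition, if_neg hrN, if_neg]
    intro h
    exact hrN (h ▸ exitState_mem_nonassigned C.preconnected hi hin hj hl)

theorem isTransitionFunctionOn_limitTransition {i : ℕ} (hi : 1 ≤ i) (hin : i < L.numMinima) :
    IsTransitionFunctionOn (L.metastates i) (C.limitTransition i) := by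
  classical
  intro r hr
  have hc := C.preconnected
  by_cases hrN : r ∈ L.nonassigned i
  · have h1 := C.pstar_self_lt_one hi hrN
    simp only [C.limitTransition_of_mem_nonassigned hi hrN]
    refine ⟨fun s => mul_nonneg (inv_nonneg.2 (sub_pos.2 h1).le)
      (Finset.sum_nonneg fun y _ => C.pstar_nonneg r y), fun s hs => ?_, ?_⟩
    · refine mul_eq_zero_of_right _ (Finset.sum_eq_zero fun y hy => ?_)
      exact absurd ((Finset.mem_filter.1 hy).2 ▸ metastateOf_mem hc hi y) hs
    · have hfib : ∑ s, ∑ y ∈ Finset.univ.erase r with L.metastateOf i y = s, C.pstar r y =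
          ∑ y ∈ Finset.univ.erase r, C.pstar r y := by
        convert Finset.sum_fiberwise (Finset.univ.erase r) (L.metastateOf i) (C.pstar r)
      rw [← Finset.mul_sum]
      refine (congrArg _ (Eq.trans (by congr!) hfib)).trans ?_
      rw [inv_mul_eq_one₀ (sub_pos.2 h1).ne',
        ← C.sum_pstar r, ← Finset.add_sum_erase _ _ (Finset.mem_univ r), add_sub_cancel_left]
  · obtain ⟨j, hj, hl, rfl⟩ := exists_eq_minimum hr hrN
    have hexit := exitState_mem_nonassigned hc hi hin hj hl
    simp only [limitTransition, if_neg hrN]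
    refine ⟨fun s => ?_, fun s hs => if_neg ?_, by simp⟩
    swap
    · rintro rfl
      exact hs (.inr hexit)
    split_ifs
    exacts [zero_le_one, le_rfl]

/-- The probabilities with which the chain moves from one valley to another converge to the limiting
transition probabilities. -/
theorem tendsto_hitProb_valley {i : ℕ} (hi : 1 ≤ i) (hin : i < L.numMinima) {r s x : S}
    (hr : r ∈ L.metastates i) (hs : s ∈ L.metastates i) (hsr : s ≠ r)
    (hx : x ∈ L.valley i r) :
    Tendsto (fun β => hitProb (C.P β) (L.valley i r) (L.valley i s) x) atTop
      (𝓝 (C.limitTransition i r s)) := by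
  classical
  have hc := C.preconnected
  have hdisj : ∀ {r s}, r ∈ L.metastates i → s ∈ L.metastates i → s ≠ r →
      Disjoint (L.valley i r) (L.valley i s) := fun hr hs hsr =>
    Set.disjoint_left.2 fun y hyr hys => hsr (eq_of_mem_valley hc hi hs hr hys hyr)
  by_cases hrN : r ∈ L.nonassigned i
  · rw [C.limitTransition_of_mem_nonassigned hi hrN]
    have hVr := valley_nonassigned hc hi hrN
    obtain rfl : x = r := by simpa [hVr] using hx
    have hxs : x ∉ L.valley i s := (hdisj hr hs hsr).notMem_of_mem_left hx
    have h1 := (sub_pos.2 (C.pstar_self_lt_one hi hrN)).ne'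
    refine ((((C.tendsto_pstar x x).const_sub 1).inv₀ h1).mul
      (tendsto_finsetSum _ fun y _ => C.tendsto_pstar x y)).congr' ?_
    have hne : ∀ᶠ β in atTop, 1 - C.P β x x ≠ 0 :=
      ((C.tendsto_pstar x x).const_sub 1).eventually_ne h1
    filter_upwards [eventually_gt_atTop 0, hne] with β hβ hne
    rw [inv_mul_eq_iff_eq_mul₀ hne]
    have heq := hitProb_eq_sum (K := L.valley i x) (T := L.valley i s) (C.isStochastic hβ) hxs hx
    -- The valley is the single state `x`; splitting off the holding term leaves an equation that
    -- can be solved for the hitting probability.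
    rw [← Finset.add_sum_erase _ _ (Finset.mem_univ x)] at heq
    rw [sub_mul, one_mul]
    nth_rewrite 1 [heq]
    rw [add_sub_cancel_left, Finset.sum_filter]
    refine Finset.sum_congr rfl fun y hy => ?_
    rw [metastateOf_eq_iff hc hi hs]
    split_ifs with hys
    · rw [hitProb_of_mem hys, mul_one]
    · rw [hitProb_of_notMem hys (by simpa [hVr] using hy), mul_zero]
  · obtain ⟨j, hj, hl, rfl⟩ := exists_eq_minimum hr hrN
    have hexit := exitState_mem_nonassigned hc hi hin hj hl
    have hVe := valley_nonassigned hc hi hexit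
    have hxj : x ∈ L.valleyOrder i j := by rwa [valley_minimum hc hi hj] at hx
    have hwhp := hitsWhp_exitState (C := C) hi hin hj hl hxj
    rw [← valley_minimum hc hi hj, ← hVe] at hwhp
    set e := L.exitState i (L.minimum j)
    have her : e ≠ L.minimum j := fun h => hrN (h ▸ hexit)
    rw [limitTransition, if_neg hrN]
    by_cases hse : s = e
    · rw [if_pos hse, hse]
      exact hwhp
    · rw [if_neg hse]
      -- Exits through different metastates are incompatible, so any other target has at most the
      -- vanishing remainder.
      have hlim : Tendsto (fun β => 1 - hitProb (C.P β) (L.valley i (L.minimum j))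
          (L.valley i e) x) atTop (𝓝 0) := by
        have := Tendsto.const_sub 1 hwhp
        rwa [sub_self] at this
      refine tendsto_of_tendsto_of_tendsto_of_le_of_le' tendsto_const_nhds hlim ?_ ?_
      · filter_upwards [eventually_gt_atTop 0] with β hβ
        exact hitProb_nonneg (C.isStochastic hβ) x
      · filter_upwards [eventually_gt_atTop 0] with β hβ
        have := hitProb_add_le_one (C.isStochastic hβ) (hdisj (.inr hexit) hs hse)
          (hdisj hr (.inr hexit) her) (hdisj hr hs hsr) x
        linarith

end LowTemperatureChain

/-! ### Convergence of the accelerated aggregated chain -/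

theorem mainTheorem6 {S : Type*} [Fintype S] (L : EnergyLandscape S) (C : LowTemperatureChain L)
    (i : ℕ) (hi : 1 ≤ i) (hi' : i < L.numMinima)
    {Ω : ℝ → Type*} [∀ β, MeasurableSpace (Ω β)] (μ : ∀ β, Measure (Ω β))
    (X : ∀ β, ℕ → Ω β → S) (hX : ∀ β > 0, IsMarkovChain (C.P β) (μ β) (X β)) :
    IsTransitionFunctionOn (L.metastates i) (C.limitTransition i) ∧
    ∀ (n : ℕ) (m : ℕ → S) (r s : S), (∀ k < n, m k ∈ L.metastates i) →
      r ∈ L.metastates i → s ∈ L.metastates i →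
      Tendsto
        (fun β => ((μ β)[|aacEvent L i (X β) n r ∩ ⋂ k < n, aacEvent L i (X β) k (m k)]).real
          (aacEvent L i (X β) (n + 1) s))
        (atTop ⊓ 𝓟 {β | μ β (aacEvent L i (X β) n r ∩ ⋂ k < n, aacEvent L i (X β) k (m k)) ≠ 0})
        (𝓝 (C.limitTransition i r s)) := by
  have htrans := C.isTransitionFunctionOn_limitTransition hi hi'
  refine ⟨htrans, fun n m r s _ hr hs => ?_⟩
  by_cases hsr : s = r
  · subst hsr
    rw [C.limitTransition_self hi hi' hr]
    -- The accelerated chain changes its value at every jump, so this conditional probability is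
    -- exactly `0` for each `β > 0`.
    refine tendsto_const_nhds.congr' (Eventually.filter_mono inf_le_left ?_)
    filter_upwards [eventually_gt_atTop 0] with β hβ
    have hmeas := (hX β hβ).measurableSet_aacEvent L i
    rw [measureReal_def, cond_apply ((hmeas n s).inter
      (.iInter fun k => .iInter fun _ => hmeas k (m k)))]
    convert ENNReal.toReal_zero.symm
    refine mul_eq_zero_of_right _ ?_
    convert measure_empty (μ := μ β)
    refine Set.eq_empty_of_forall_notMem ?_
    rintro ω ⟨⟨⟨t, ht, hys⟩, -⟩, hω⟩
    exact ((acceleratedEq_succ_iff ht).1 hω).1 hys.symm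
  · rw [Metric.tendsto_nhds]
    intro ε hε
    -- Finiteness of the valley makes the bounds uniform in the starting point; the closed interval
    -- of radius `ε / 2` leaves room for the strict bound by `ε`.
    have hev : ∀ᶠ β in atTop, ∀ x ∈ L.valley i r,
        hitProb (C.P β) (L.valley i r) (L.valley i s) x ∈
          Set.Icc (C.limitTransition i r s - ε / 2) (C.limitTransition i r s + ε / 2) := by
      refine (Set.toFinite (L.valley i r)).eventually_all.2 fun x hx => ?_
      exact C.tendsto_hitProb_valley hi hi' hr hs hsr hx
        (Icc_mem_nhds (by linarith) (by linarith))
    refine eventually_inf_principal.2 ?_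
    filter_upwards [hev, eventually_gt_atTop 0] with β h hβ h0
    have h1 := (htrans r hr).1 s
    have hmem := (hX β hβ).cond_aacEvent_mem_Icc (C.isStochastic hβ) C.preconnected hi hr hs hsr
      (by linarith) h h0
    rw [Real.dist_eq, abs_lt]
    constructor <;> linarith [hmem.1, hmem.2]
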